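/- **Setting.** Let $d\ge 1$. For $u\in L^1(\mathbb R^n)$ put $\mathbf F_n u(\xi)=\int u(x)e^{-ix\cdot\xi}\,dx$, let $\circledast$ be convolution on $\mathbb R^n$, and $u^*(x)=u(-x)$. All functions are real-valued. *Multiscale decomposition.* A sequence $(v_j)_{j\ge 0}$ in $L^1(\mathbb R)\cap L^2(\mathbb R)$ is a multiscale decomposition of $L^2(\mathbb R)$ if there is $w\in L^1(\mathbb R)\cap L^2(\mathbb R)$ with $v_j(t)=2^j w(2^jt)$ for all $j\ge 1$, and there are $A,B>0$ with $A\|g\|_2^2\le\sum_{j}\|g\circledast v_j\|_2^2\le B\|g\|_2^2$ for all $g\in L^2(\mathbb R)$. *The filters.* With $D=\frac1{2t}\frac{d}{dt}$, for even $v$ define $\mathbf R^\sharp v:\mathbb R^d\to\mathbb R$ by $$\mathbf R^\sharp v(x)=\begin{cases}\dfrac{(-1)^{(d-1)/2}}{\sqrt{\pi^{d-1}}}\,\bigl(D^{(d-1)/2}v\bigr)(\|x\|), & d \text{ odd},\\[2mm] \dfrac{2(-1)^{d/2}}{\sqrt{\pi^{d}}}\displaystyle\int_{\|x\|}^\infty\frac{(D^{d/2}v)(t)}{\sqrt{t^2-\|x\|^2}}\,t\,dt,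 & d\text{ even}.\end{cases}$$ *The wave operator.* For $f\in C^\infty(\mathbb R^d)$ let $p$ be the smooth solution on $\mathbb R^d\times[0,\infty)$ of $p_{tt}-\Delta p=0$ for $t>0$, $p(\cdot,0)=f$, $p_t(\cdot,0)=0$. For a set $S\subseteq\mathbb R^d$ put $\mathbf W f=p|_{S\times(0,\infty)}$. For $g:S\times(0,\infty)\to\mathbb R$ put $(v\circledast_t g)(z,t)=\int_{\mathbb R}v(s)\,g(z,|t-s|)\,ds$, that is, the data are extended evenly in time. **Corollary (Multiscale reconstruction).** Let $(v_j)_{j\ge0}$ be a multiscale decomposition of $L^2(\mathbb R)$ consisting of even functions $v_j\in C^{\lceil (d-1)/2\rceil}(\mathbb R)$ with sufficient decay in the following sense: for every $j$ there are $C,\varepsilon>0$ such that $|v_j^{(i)}(t)|\le C(1+|t|)^{-(i+1+\varepsilon)}$ for all $t\in\mathbb R$ and all $0\le i\le\lceil (d-1)/2\rceil$. Put $u_j=\mathbf R^\sharp v_j$. Then $u_j\in L^1(\mathbb R^d)$ for all $j$, the series $\sum_j|\mathbf F_du_j|^2$ converges almost everywhere, and its inverse Fourier transform $$\Phi=\mathbf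 F_d^{-1}\Bigl(\sum_{j\ge 0}|\mathbf F_du_j|^2\Bigr)$$ is a well-defined tempered distribution. For every $f\in C_c^\infty(\mathbb R^d)$ the factors $f_j=u_j\circledast f$ satisfy $$\Phi\circledast f=\sum_{j\ge 0}u_j^*\circledast f_j ,$$ where $(\Phi\circledast f)(x)=\langle\Phi,f(x-\cdot)\rangle$ and the series converges absolutely in $L^2(\mathbb R^d)$. Moreover the initial value problems with initial data $f$ and $f_j$ have unique smooth solutions, and for every $S\subseteq\mathbb R^d$ and every $j$ $$\mathbf W f_j=v_j\circledast_t\mathbf W f\quad\text{on } S\times(0,\infty),$$ where the integral defining the right-hand side converges absolutely. -/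

import Mathlib

open MeasureTheory Set Filter Topology
open scoped ENNReal NNReal ContDiff SchwartzMap Laplacian

namespace MultiscalePAT

noncomputable section

/-! ### Convolutions and convolutional frames -/

section Frames

variable {E : Type*} [NormedAddCommGroup E] [InnerProductSpace ℝ E] [MeasureSpace E]

/-- Convolution of real-valued functions, `(u ⊛ f)(x) = ∫ u(y) f(x - y) dy`. -/
abbrev conv (u f : E → ℝ) : E → ℝ :=
  convolution u f (ContinuousLinearMap.mul ℝ ℝ) volume

/-- The involution `u^*(x) = u(-x)`. -/
def reflect (u : E → ℝ) : E → ℝ := fun x => u (-x)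

/-- A convolutional frame: functions `u_i ∈ L¹ ∩ L²` with
`A ‖f‖² ≤ ∑ᵢ ‖f ⊛ u_i‖² ≤ B ‖f‖²` for all `f ∈ L²`, where `A, B > 0`. -/
def IsConvFrame {ι : Type*} (u : ι → E → ℝ) : Prop :=
  (∀ i, MemLp (u i) 1 volume ∧ MemLp (u i) 2 volume) ∧
  ∃ A B : ℝ≥0, 0 < A ∧ 0 < B ∧ ∀ f : E → ℝ, MemLp f 2 volume →
    A * eLpNorm f 2 volume ^ 2 ≤ ∑' i, eLpNorm (conv f (u i)) 2 volume ^ 2 ∧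
    ∑' i, eLpNorm (conv f (u i)) 2 volume ^ 2 ≤ B * eLpNorm f 2 volume ^ 2

/-- A multiscale (convolution) decomposition of `L²(E)`, `n = dim E`: a convolutional frame
`(u_j)_{j ≥ 0}` such that `u_j(x) = 2^{jn} u(2^j x)`, `j ≥ 1`, for some `u ∈ L¹ ∩ L²`. -/
def IsMultiscaleDecomposition (u : ℕ → E → ℝ) : Prop :=
  IsConvFrame u ∧
  ∃ w : E → ℝ, MemLp w 1 volume ∧ MemLp w 2 volume ∧
    ∀ j, 1 ≤ j → ∀ x, u j x = 2 ^ (j * Module.finrank ℝ E) * w ((2 : ℝ) ^ j • x)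

/-- The Fourier transform `F u(ξ) = ∫ u(x) e^{-i x·ξ} dx`. -/
def fourierD (u : E → ℝ) (ξ : E) : ℂ :=
  ∫ x, (u x : ℂ) * Complex.exp (-(Complex.I * (inner ℝ x ξ : ℝ)))

/-- The inverse transform `F⁻¹ φ(ξ) = (2π)^{-n} ∫ φ(x) e^{i x·ξ} dx`, `n = dim E`. -/
def fourierInvD (φ : E → ℂ) (ξ : E) : ℂ :=
  ((2 * Real.pi : ℝ) ^ Module.finrank ℝ E : ℝ)⁻¹ *
    ∫ x, φ x * Complex.exp (Complex.I * (inner ℝ x ξ : ℝ))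

/-- The tempered distribution `Φ` is the inverse Fourier transform of the function `m`, in the
usual sense of distributions: `⟨Φ, φ⟩ = ⟨m, F⁻¹ φ⟩ = ∫ m(ξ) (F⁻¹ φ)(ξ) dξ` for every Schwartz
function `φ`, the integral being absolutely convergent. -/
def IsInverseFourier (m : E → ℝ) (Φ : 𝓢'(E, ℂ)) : Prop :=
  ∀ φ : 𝓢(E, ℂ), Integrable (fun ξ => (m ξ : ℂ) * fourierInvD φ ξ) volume ∧
    Φ φ = ∫ ξ, (m ξ : ℂ) * fourierInvD φ ξ

end Frames

section DistConv

variable {E : Type*} [NormedAddCommGroup E] [NormedSpace ℝ E]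

/-- The Schwartz function `y ↦ φ(x - y)`. -/
def reflTranslate (x : E) (φ : 𝓢(E, ℂ)) : 𝓢(E, ℂ) :=
  SchwartzMap.compSubConstCLM ℂ x
    (SchwartzMap.compCLMOfContinuousLinearEquiv ℂ (ContinuousLinearEquiv.neg ℝ) φ)

theorem reflTranslate_apply (x y : E) (φ : 𝓢(E, ℂ)) : reflTranslate x φ y = φ (x - y) := by
  simp [reflTranslate]

/-- Convolution of a tempered distribution with a Schwartz function,
`(Φ ⊛ φ)(x) = ⟨Φ, φ(x - ·)⟩`. -/
def distConv (Φ : 𝓢'(E, ℂ)) (φ : 𝓢(E, ℂ)) (x : E) : ℂ := Φ (reflTranslate x φ)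

/-- A real function `f ∈ C_c^∞`, viewed as a complex-valued Schwartz function. -/
def testFunction (f : E → ℝ) (hf : ContDiff ℝ ∞ f) (hc : HasCompactSupport f) : 𝓢(E, ℂ) :=
  HasCompactSupport.toSchwartzMap (f := fun x => (f x : ℂ))
    (hc.comp_left (g := Complex.ofReal) Complex.ofReal_zero)
    (Complex.ofRealCLM.contDiff.comp hf)

theorem testFunction_apply (f : E → ℝ) (hf : ContDiff ℝ ∞ f) (hc : HasCompactSupport f) (x : E) :
    testFunction f hf hc x = (f x : ℂ) := rfl

end DistConv

/-! ### The filters `R^♯ v` -/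

/-- The operator `1/(2t) d/dt`. -/
def radialD (g : ℝ → ℝ) : ℝ → ℝ := fun t => 1 / (2 * t) * deriv g t

/-- The radial function `R^♯ v : ℝ^d → ℝ`, with `D = 1/(2t) d/dt`:
`(-1)^{(d-1)/2} π^{-(d-1)/2} (D^{(d-1)/2} v)(|x|)` for `d` odd and
`2 (-1)^{d/2} π^{-d/2} ∫_{|x|}^∞ (D^{d/2} v)(t) (t² - |x|²)^{-1/2} t dt` for `d` even. -/
def radonSharp (d : ℕ) (v : ℝ → ℝ) (x : EuclideanSpace ℝ (Fin d)) : ℝ :=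
  if Odd d then
    (-1) ^ ((d - 1) / 2) / √(Real.pi ^ (d - 1)) * (radialD^[(d - 1) / 2] v) ‖x‖
  else
    2 * (-1) ^ (d / 2) / √(Real.pi ^ d) *
      ∫ t in Ioi ‖x‖, (radialD^[d / 2] v) t / √(t ^ 2 - ‖x‖ ^ 2) * t

/-- Decay of `v` in dimension `d`: `|v^{(i)}(t)| ≤ C (1 + |t|)^{-(i + 1 + ε)}` for all
`0 ≤ i ≤ ⌈(d - 1) / 2⌉`, with some `ε > 0`. (In `ℕ`, `d / 2 = ⌈(d - 1) / 2⌉` for `d ≥ 1`.) -/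
def HasSufficientDecay (d : ℕ) (v : ℝ → ℝ) : Prop :=
  ∃ C ε : ℝ, 0 < ε ∧ ∀ i : ℕ, i ≤ d / 2 → ∀ t : ℝ,
    |iteratedDeriv i v t| ≤ C * (1 + |t|) ^ (-((i : ℝ) + 1 + ε))

/-! ### The wave equation and the operator `W` -/

section Wave

variable {E : Type*} [NormedAddCommGroup E] [InnerProductSpace ℝ E] [FiniteDimensional ℝ E]

/-- The closed half-space `E × [0, ∞)` of space-time. -/
def halfSpace (E : Type*) : Set (E × ℝ) := univ ×ˢ Ici (0 : ℝ)

/-- `p` is a smooth solution on `E × [0, ∞)` of `p_tt - Δ p = 0` on `E × (0, ∞)`,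
`p(·, 0) = f`, `p_t(·, 0) = 0`. -/
structure IsWaveSolution (f : E → ℝ) (p : E × ℝ → ℝ) : Prop where
  smooth : ContDiffOn ℝ ∞ p (halfSpace E)
  wave : ∀ x : E, ∀ t : ℝ, 0 < t →
    iteratedDeriv 2 (fun τ => p (x, τ)) t - Δ (fun y => p (y, t)) x = 0
  initial : ∀ x : E, p (x, 0) = f x
  initial_deriv : ∀ x : E, HasDerivWithinAt (fun τ => p (x, τ)) 0 (Ici 0) 0

/-- The initial value problem with initial pressure `f` has exactly one smooth solution. -/
def IsWellPosed (f : E → ℝ) : Prop :=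
  ∃ p, IsWaveSolution f p ∧ ∀ q, IsWaveSolution f q → EqOn q p (halfSpace E)

open Classical in
/-- The forward operator `W f = p|_{S × (0, ∞)}`, where `p` is the solution of the wave equation
with initial pressure `f` (meaningful whenever `IsWellPosed f`). -/
def waveOp (S : Set E) (f : E → ℝ) : S × Ioi (0 : ℝ) → ℝ := fun z =>
  if h : ∃ p, IsWaveSolution f p then h.choose ((z.1 : E), (z.2 : ℝ)) else 0

/-- The even extension to `ℝ` of a function of time `t > 0` (with the irrelevant value `0` at
`t = 0`). -/
def evenExt (g : Ioi (0 : ℝ) → ℝ) : ℝ → ℝ := fun t =>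
  if h : 0 < |t| then g ⟨|t|, h⟩ else 0

/-- Convolution in the time variable of data `g` on `S × (0, ∞)`, extended evenly in time:
`(v ⊛_t g)(z, t) = ∫_ℝ v(s) g(z, |t - s|) ds`. -/
def timeConv {S : Set E} (v : ℝ → ℝ) (g : S × Ioi (0 : ℝ) → ℝ) : S × Ioi (0 : ℝ) → ℝ := fun z =>
  conv v (evenExt fun τ => g (z.1, τ)) (z.2 : ℝ)

end Wave

end

end MultiscalePAT

open MultiscalePAT

/-!
The proof rests on the identity `F_d (R^♯ v)(ξ) = v̂(‖ξ‖)`, which says that `R^♯ v` is the radial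
function with Radon transform `v`. In odd dimension `d = 2k + 1` the operator `D` is `d/dq` in the
variable `q = r²`, so that integrating `D^k v` over a hyperplane at distance `|s|` from the origin,
where `q` carries the weight `q^{k-1}`, undoes all derivatives and leaves `(-π)^k v(s)`
(`integral_shifted`, `integral_slice_radialD`); the Fourier slice identity `fourierD_radialD_norm`
follows. In even dimension `d = 2k` the Abel integral in the definition of `R^♯` is the integral of
the `(2k+1)`-dimensional function over one additional coordinate (`radonSharp_even`), which on the
Fourier side is restriction to a hyperplane. Both cases are collected in `radonSharp_spec`.

The multiplier `m = ∑ |F u_j|² = ∑ |v̂_j(‖·‖)|²` is bounded everywhere, because the upper frame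
bound, tested on plane waves truncated to long intervals, bounds `∑ |v̂_j(η)|²` at each frequency
(`sum_sq_fourierD_le`). Hence `Φ` exists, and convolution with `Φ` is multiplication by `m` on the
Fourier side. Absolute convergence in `L²` needs more than Plancherel for each term. Summability
along `v̂_{j+1}(η) = v̂_1(2^{-j} η)` forces `v̂_1(0) = 0`, and the decay of `v_1` makes `v̂_1` Hölder
continuous at `0`, so that `|F u_j(ξ)|² ≤ D q^j (1 + ‖ξ‖²)` with `q < 1`
(`exists_geometric_bound`). Since `F f` is a Schwartz function, the terms and the remainders of the
series then decay geometrically in `L²` (`eLpNorm_multiplier_le`).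

The wave equation with initial pressure `F⁻¹ h` is solved by `Re F⁻¹(cos(‖ξ‖ t) h)`; seen as a
Fourier integral over the light cone in space-time, this function is smooth and a solution as soon
as `h` has all moments (`isWaveSolution_waveSol`). Solutions are unique by the energy method, with
a smooth weight supported in a backward light cone (`IsWaveSolution.eqOn`). For even `v`, convolving
`cos(‖ξ‖ t)` with `v` in time multiplies it by `v̂(‖ξ‖) = F u(ξ)` (`integral_mul_waveSol`), which is
the intertwining relation between `W` and convolution with `u`.
-/

namespace MultiscalePAT

open scoped FourierTransform

/-! ### The Fourier transform without `2π` in the exponent -/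

section FourierConventions

variable {E : Type*} [NormedAddCommGroup E] [InnerProductSpace ℝ E] [FiniteDimensional ℝ E]
  [MeasurableSpace E] [BorelSpace E]

theorem fourierD_eq_fourier (u : E → ℝ) (ξ : E) :
    fourierD u ξ = 𝓕 (fun x => (u x : ℂ)) ((2 * Real.pi)⁻¹ • ξ) := by
  rw [fourierD, Real.fourier_eq']
  refine integral_congr_ae (.of_forall fun x => ?_)
  simp only [smul_eq_mul, inner_smul_right]
  rw [mul_comm]
  congr 2
  push_cast
  have : (Real.pi : ℂ) ≠ 0 := by exact_mod_cast Real.pi_ne_zero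
  field_simp

theorem fourierInvD_eq_fourierInv (φ : E → ℂ) (x : E) :
    fourierInvD φ x = 𝓕⁻ (fun η => φ ((2 * Real.pi) • η)) x := by
  rw [fourierInvD, Real.fourierInv_eq']
  have h := Measure.integral_comp_smul (volume : Measure E)
    (fun ξ => φ ξ * Complex.exp (Complex.I * (inner ℝ ξ x : ℝ))) (2 * Real.pi)
  rw [abs_of_nonneg (by positivity)] at h
  rw [← Complex.real_smul, ← h]
  refine integral_congr_ae (.of_forall fun η => ?_)
  simp only [smul_eq_mul, inner_smul_left]
  rw [mul_comm]
  congr 2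
  push_cast
  simp
  ring

theorem norm_fourierD_le (u : E → ℝ) (ξ : E) : ‖fourierD u ξ‖ ≤ ∫ x, |u x| := by
  refine (norm_integral_le_integral_norm _).trans (le_of_eq ?_)
  refine integral_congr_ae (.of_forall fun x => ?_)
  have : ‖Complex.exp (-(Complex.I * (inner ℝ x ξ : ℝ)))‖ = 1 := by
    rw [Complex.norm_exp]; simp
  simp [this]

theorem continuous_fourierD {u : E → ℝ} (hu : Integrable u) : Continuous (fourierD u) := by
  have h : Continuous (𝓕 (fun x => (u x : ℂ))) :=
    VectorFourier.fourierIntegral_continuous Real.continuous_fourierChar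
      (by exact continuous_inner) hu.ofReal
  have : fourierD u = fun ξ => 𝓕 (fun x => (u x : ℂ)) ((2 * Real.pi)⁻¹ • ξ) :=
    funext fun ξ => fourierD_eq_fourier u ξ
  rw [this]
  fun_prop

theorem fourierD_reflect (u : E → ℝ) (ξ : E) :
    fourierD (reflect u) ξ = starRingEnd ℂ (fourierD u ξ) := by
  rw [fourierD, fourierD, ← integral_conj,
    ← integral_neg_eq_self (fun x => (starRingEnd ℂ) _)]
  refine integral_congr_ae (.of_forall fun x => ?_)
  simp [reflect, ← Complex.exp_conj]

/-- The Fourier transform of a test function is a Schwartz function. -/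
theorem exists_schwartz_eq_fourierD {f : E → ℝ} (hf : ContDiff ℝ ∞ f) (hc : HasCompactSupport f) :
    ∃ T : 𝓢(E, ℂ), ∀ ξ, fourierD f ξ = T ξ := by
  have h0 : (2 * Real.pi)⁻¹ ≠ (0 : ℝ) := by positivity
  refine ⟨SchwartzMap.compCLMOfContinuousLinearEquiv ℂ
    (ContinuousLinearEquiv.smulLeft (Units.mk0 _ h0)) (𝓕 (testFunction f hf hc)), fun ξ => ?_⟩
  rw [fourierD_eq_fourier, SchwartzMap.compCLMOfContinuousLinearEquiv_apply,
    Function.comp_apply, SchwartzMap.fourier_coe]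
  rfl

/-- Fourier inversion for test functions. -/
theorem fourierInvD_fourierD {f : E → ℝ} (hf : ContDiff ℝ ∞ f) (hc : HasCompactSupport f) (x : E) :
    fourierInvD (fourierD f) x = (f x : ℂ) := by
  rw [fourierInvD_eq_fourierInv]
  have : (fun η : E => fourierD f ((2 * Real.pi) • η)) = 𝓕 (fun x => (f x : ℂ)) := by
    ext η
    rw [fourierD_eq_fourier, smul_smul, inv_mul_cancel₀ (by positivity), one_smul]
  rw [this]
  have h1 : 𝓕⁻ (𝓕 (testFunction f hf hc)) = testFunction f hf hc :=
    FourierTransform.fourierInv_fourier_eq _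
  have h2 := congrArg (fun T : 𝓢(E, ℂ) => T x) h1
  rw [SchwartzMap.fourierInv_coe, SchwartzMap.fourier_coe] at h2
  exact h2

theorem norm_exp_I_mul (a : ℝ) : ‖Complex.exp (Complex.I * (a : ℂ))‖ = 1 := by
  rw [Complex.norm_exp]; simp

theorem integrable_mul_exp {h : E → ℂ} (hh : Integrable h) (x : E) :
    Integrable fun ξ => h ξ * Complex.exp (Complex.I * (inner ℝ ξ x : ℝ)) := by
  refine hh.mul_bdd (c := 1) (by fun_prop) (.of_forall fun ξ => ?_)
  rw [norm_exp_I_mul]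

theorem fourierInvD_sub {g h : E → ℂ} (hg : Integrable g) (hh : Integrable h) (x : E) :
    fourierInvD (fun ξ => g ξ - h ξ) x = fourierInvD g x - fourierInvD h x := by
  simp only [fourierInvD, sub_mul]
  rw [integral_sub (integrable_mul_exp hg x) (integrable_mul_exp hh x), mul_sub]

theorem fourierInvD_sum {ι : Type*} (s : Finset ι) {g : ι → E → ℂ} (hg : ∀ i ∈ s, Integrable (g i))
    (x : E) : fourierInvD (fun ξ => ∑ i ∈ s, g i ξ) x = ∑ i ∈ s, fourierInvD (g i) x := by
  simp only [fourierInvD, Finset.sum_mul]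
  rw [integral_finsetSum _ (fun i hi => integrable_mul_exp (hg i hi) x), Finset.mul_sum]

/-- Convolution with an integrable function multiplies the Fourier transform. -/
theorem conv_eq_fourierInvD {u f : E → ℝ} {h : E → ℂ} (hu : Integrable u) (hh : Integrable h)
    (hf : ∀ x, (f x : ℂ) = fourierInvD h x) (x : E) :
    (conv u f x : ℂ) = fourierInvD (fun ξ => fourierD u ξ * h ξ) x := by
  have h1 : (conv u f x : ℂ) = ∫ y, (u y : ℂ) * fourierInvD h (x - y) := by
    rw [conv, convolution, ← integral_complex_ofReal]
    refine integral_congr_ae (.of_forall fun y => ?_)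
    simp [hf]
  rw [h1]
  simp only [fourierInvD, fourierD]
  set c : ℂ := ((((2 * Real.pi : ℝ) ^ Module.finrank ℝ E : ℝ)⁻¹ : ℝ) : ℂ)
  have h2 : ∀ y, (u y : ℂ) * (c * ∫ ξ, h ξ * Complex.exp (Complex.I * (inner ℝ ξ (x - y) : ℝ)))
      = c * ∫ ξ, (u y : ℂ) * (h ξ * Complex.exp (Complex.I * (inner ℝ ξ (x - y) : ℝ))) := by
    intro y
    rw [integral_const_mul]; ring
  simp_rw [h2]
  rw [integral_const_mul]
  congr 1
  rw [integral_integral_swap]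
  · refine integral_congr_ae (.of_forall fun ξ => ?_)
    simp only
    rw [← integral_mul_const, ← integral_mul_const]
    refine integral_congr_ae (.of_forall fun y => ?_)
    simp only [inner_sub_right]
    have : Complex.exp (Complex.I * ((inner ℝ ξ x - inner ℝ ξ y : ℝ) : ℂ)) =
        Complex.exp (-(Complex.I * (inner ℝ ξ y : ℝ))) *
          Complex.exp (Complex.I * (inner ℝ ξ x : ℝ)) := by
      rw [← Complex.exp_add]; congr 1; push_cast; ring
    rw [this, real_inner_comm ξ y]; ring
  · have := (hu.ofReal (𝕜 := ℂ)).mul_prod hh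
    have h3 : Integrable (fun z : E × E => ((u z.1 : ℂ) * h z.2) *
        Complex.exp (Complex.I * (inner ℝ z.2 (x - z.1) : ℝ))) (volume.prod volume) := by
      refine this.mul_bdd (c := 1) (by fun_prop) (.of_forall fun ξ => ?_)
      rw [norm_exp_I_mul]
    refine h3.congr (.of_forall fun z => ?_)
    simp only [Function.uncurry]; ring

/-- The inverse Fourier integral of a function in `L¹ ∩ L²` agrees with its `L²` transform. -/
theorem fourierInv_toLp_ae_eq {h : E → ℂ} (h1 : Integrable h) (h2 : MemLp h 2) :
    ((𝓕⁻ (h2.toLp h) : Lp ℂ 2 (volume : Measure E)) : E → ℂ) =ᵐ[volume] 𝓕⁻ h := by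
  have hcont : Continuous (𝓕⁻ h) := by
    have h3 : Continuous (𝓕 h) :=
      VectorFourier.fourierIntegral_continuous Real.continuous_fourierChar
        (by exact continuous_inner) h1
    have : 𝓕⁻ h = fun x => 𝓕 h (-x) := funext fun x => Real.fourierInv_eq_fourier_neg h x
    rw [this]; fun_prop
  refine ae_eq_of_integral_contDiff_smul_eq
    ((Lp.memLp _).locallyIntegrable (by norm_num)) hcont.locallyIntegrable fun g hg hgc => ?_
  have h4 := congrArg (fun T : 𝓢'(E, ℂ) => T (testFunction g hg hgc))
    (Lp.fourierInv_toTemperedDistribution_eq (h2.toLp h))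
  simp only [TemperedDistribution.fourierInv_apply, Lp.toTemperedDistribution_apply] at h4
  have h5 : ∫ x, (testFunction g hg hgc x) • (𝓕⁻ (h2.toLp h) : Lp ℂ 2 (volume : Measure E)) x =
      ∫ x, g x • (𝓕⁻ (h2.toLp h) : Lp ℂ 2 (volume : Measure E)) x := by
    refine integral_congr_ae (.of_forall fun x => ?_)
    simp [testFunction_apply]
  rw [← h5, ← h4]
  have h6 : ∫ x, (𝓕⁻ (testFunction g hg hgc)) x • (h2.toLp h) x =
      ∫ x, (𝓕⁻ (testFunction g hg hgc)) x • h x := by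
    refine integral_congr_ae ?_
    filter_upwards [h2.coeFn_toLp] with x hx
    rw [hx]
  rw [h6]
  have h7 : Integrable (fun x => (g x : ℂ)) := (testFunction g hg hgc).integrable
  have h8 := VectorFourier.integral_fourierIntegral_smul_eq_flip (μ := (volume : Measure E))
    (ν := (volume : Measure E)) (L := -(innerₗ E)) Real.continuous_fourierChar
    (by
      change Continuous fun p : E × E => -(inner ℝ p.1 p.2)
      exact continuous_inner.neg) h7 h1
  have h9 : ∀ (k : E → ℂ) (x : E), VectorFourier.fourierIntegral Real.fourierChar volume
      (-(innerₗ E)) k x = 𝓕⁻ k x := by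
    intro k x
    rw [Real.fourierInv_eq, VectorFourier.fourierIntegral]
    simp
  have h10 : ∀ (k : E → ℂ) (x : E), VectorFourier.fourierIntegral Real.fourierChar volume
      (-(innerₗ E)).flip k x = 𝓕⁻ k x := by
    intro k x
    rw [Real.fourierInv_eq, VectorFourier.fourierIntegral]
    simp [real_inner_comm]
  simp only [h9, h10] at h8
  rw [SchwartzMap.fourierInv_coe]
  simpa using! h8

/-- Plancherel for `fourierInvD` on `L¹ ∩ L²`; the normalising constant `(2π)^{-dim E / 2}` is
bounded by `1`. -/
theorem eLpNorm_fourierInvD_le {h : E → ℂ} (h1 : Integrable h) (h2 : MemLp h 2) :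
    MemLp (fourierInvD h) 2 volume ∧
      eLpNorm (fourierInvD h) 2 volume ≤ eLpNorm h 2 volume := by
  have hpi : (2 * Real.pi) ≠ (0 : ℝ) := by positivity
  set c : ℝ≥0∞ := ENNReal.ofReal |((2 * Real.pi) ^ Module.finrank ℝ E)⁻¹| with hc
  have hc1 : c ≤ 1 := by
    rw [hc, ENNReal.ofReal_le_one, abs_of_nonneg (by positivity)]
    refine inv_le_one_of_one_le₀ (one_le_pow₀ ?_)
    nlinarith [Real.pi_gt_three]
  have hmap : Measure.map (fun η : E => (2 * Real.pi) • η) volume = c • volume :=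
    Measure.map_addHaar_smul volume hpi
  have hmeas : AEStronglyMeasurable h (Measure.map (fun η : E => (2 * Real.pi) • η) volume) := by
    rw [hmap]; exact h1.1.smul_measure c
  have hk1 : Integrable fun η => h ((2 * Real.pi) • η) := h1.comp_smul hpi
  have hnorm : eLpNorm (fun η => h ((2 * Real.pi) • η)) 2 volume ≤ eLpNorm h 2 volume := by
    have := eLpNorm_map_measure (p := 2) hmeas (by fun_prop)
    rw [hmap] at this
    change eLpNorm (h ∘ fun η : E => (2 * Real.pi) • η) 2 volume ≤ _
    rw [← this]
    refine eLpNorm_mono_measure _ ?_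
    refine Measure.le_iff.2 fun s _ => ?_
    simpa using mul_le_mul_left hc1 (volume s)
  have hk2 : MemLp (fun η => h ((2 * Real.pi) • η)) 2 := ⟨hk1.1, hnorm.trans_lt h2.2⟩
  have hae := fourierInv_toLp_ae_eq hk1 hk2
  have hfun : fourierInvD h = 𝓕⁻ (fun η => h ((2 * Real.pi) • η)) :=
    funext fun x => fourierInvD_eq_fourierInv h x
  have hpl : ‖(𝓕⁻ (hk2.toLp _) : Lp ℂ 2 (volume : Measure E))‖ = ‖hk2.toLp _‖ := by
    rw [← Lp.norm_fourier_eq, FourierTransform.fourier_fourierInv_eq]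
  rw [hfun]
  refine ⟨(memLp_congr_ae hae).1 (Lp.memLp _), ?_⟩
  rw [← eLpNorm_congr_ae hae]
  refine le_trans (le_of_eq ?_) hnorm
  rw [← Lp.enorm_def, ← Lp.enorm_toLp (hf := hk2), ← ofReal_norm, ← ofReal_norm, hpl]

end FourierConventions

/-! ### Existence for the wave equation -/

section WaveExistence

theorem two_le_infty : (2 : WithTop ℕ∞) ≤ (∞ : WithTop ℕ∞) :=
  show ((2 : ℕ∞) : WithTop ℕ∞) ≤ ((⊤ : ℕ∞) : WithTop ℕ∞) from WithTop.coe_le_coe.2 le_top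

/-- Second derivatives of a composition with an affine map. -/
theorem fderiv_fderiv_comp_affine {X W F : Type*} [NormedAddCommGroup X] [NormedSpace ℝ X]
    [NormedAddCommGroup W] [NormedSpace ℝ W] [NormedAddCommGroup F] [NormedSpace ℝ F]
    {f : W → F} {A : X → W} {L : X →L[ℝ] W} {x : X} (hf : ContDiffAt ℝ 2 f (A x))
    (hA : ∀ y, HasFDerivAt A L y) (a b : X) :
    fderiv ℝ (fderiv ℝ fun y => f (A y)) x a b = fderiv ℝ (fderiv ℝ f) (A x) (L a) (L b) := by
  have h1 : ∀ᶠ y in 𝓝 x, fderiv ℝ (fun y => f (A y)) y = (fderiv ℝ f (A y)).comp L := by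
    have h2 : ∀ᶠ w in 𝓝 (A x), ContDiffAt ℝ 2 f w := hf.eventually (by simp)
    filter_upwards [(hA x).continuousAt.eventually h2] with y hy
    exact ((hy.differentiableAt (by simp)).hasFDerivAt.comp y (hA y)).fderiv
  rw [Filter.EventuallyEq.fderiv_eq h1]
  have h3 : HasFDerivAt (fun y => fderiv ℝ f (A y)) ((fderiv ℝ (fderiv ℝ f) (A x)).comp L) x :=
    ((hf.fderiv_right (m := 1) (by norm_num)).differentiableAt (by simp)).hasFDerivAt.comp x (hA x)
  have h4 := (((ContinuousLinearMap.compL ℝ X W F).flip L).hasFDerivAt.comp x h3).fderiv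
  change fderiv ℝ (fun y => (fderiv ℝ f (A y)).comp L) x = _ at h4
  rw [h4]
  rfl

variable {E : Type*} [NormedAddCommGroup E] [InnerProductSpace ℝ E] [FiniteDimensional ℝ E]

omit [FiniteDimensional ℝ E] in
theorem iteratedDeriv_two_time_slice {f : E × ℝ → ℝ} {x : E} {t : ℝ}
    (hf : ContDiffAt ℝ 2 f (x, t)) :
    iteratedDeriv 2 (fun τ => f (x, τ)) t = fderiv ℝ (fderiv ℝ f) (x, t) (0, 1) (0, 1) := by
  rw [iteratedDeriv_eq_iteratedFDeriv, iteratedFDeriv_two_apply]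
  have := fderiv_fderiv_comp_affine (f := f) (A := fun τ : ℝ => (x, τ))
    (L := ContinuousLinearMap.inr ℝ E ℝ) hf (fun y => hasFDerivAt_prodMk_right x y) 1 1
  simpa using this

theorem laplacian_space_slice {ι : Type*} [Fintype ι] (b : OrthonormalBasis ι ℝ E)
    {f : E × ℝ → ℝ} {x : E} {t : ℝ} (hf : ContDiffAt ℝ 2 f (x, t)) :
    Δ (fun y => f (y, t)) x = ∑ i, fderiv ℝ (fderiv ℝ f) (x, t) (b i, 0) (b i, 0) := by
  rw [InnerProductSpace.laplacian_eq_iteratedFDeriv_orthonormalBasis _ b]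
  refine Finset.sum_congr rfl fun i _ => ?_
  rw [iteratedFDeriv_two_apply]
  have := fderiv_fderiv_comp_affine (f := f) (A := fun y : E => (y, t))
    (L := ContinuousLinearMap.inl ℝ E ℝ) hf (fun y => hasFDerivAt_prodMk_left y t) (b i) (b i)
  simpa using this

variable [MeasurableSpace E] [BorelSpace E]

/-- The function `(x, t) ↦ Re F⁻¹(cos(‖ξ‖ t) h(ξ))(x)`: the solution of the wave equation whose
initial pressure has Fourier transform `h`. -/
noncomputable def waveSol (h : E → ℂ) : E × ℝ → ℝ := fun z =>
  (fourierInvD (fun ξ => (Real.cos (‖ξ‖ * z.2) : ℂ) * h ξ) z.1).re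

/-- The image of Lebesgue measure on both sheets of the light cone `τ = ± ‖ξ‖`. -/
noncomputable def coneMeasure (E : Type*) [NormedAddCommGroup E] [InnerProductSpace ℝ E]
    [FiniteDimensional ℝ E] [MeasurableSpace E] [BorelSpace E] : Measure (E × ℝ) :=
  Measure.map (fun ξ : E => (ξ, ‖ξ‖)) volume + Measure.map (fun ξ : E => (ξ, -‖ξ‖)) volume

/-- The pairing `-(⟨ξ, x⟩ + τ t) / 2π` of frequency space with space-time; the factor compensates
the normalisation of Mathlib's Fourier integral. -/
noncomputable def spaceTimePairing (E : Type*) [NormedAddCommGroup E] [InnerProductSpace ℝ E] :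
    (E × ℝ) →L[ℝ] (E × ℝ) →L[ℝ] ℝ :=
  (-(2 * Real.pi)⁻¹) •
    ((isBoundedBilinearMap_inner (𝕜 := ℝ) (E := E)).toContinuousLinearMap.bilinearComp (ContinuousLinearMap.fst ℝ E ℝ)
        (ContinuousLinearMap.fst ℝ E ℝ) +
      (ContinuousLinearMap.mul ℝ ℝ).bilinearComp (ContinuousLinearMap.snd ℝ E ℝ)
        (ContinuousLinearMap.snd ℝ E ℝ))

omit [FiniteDimensional ℝ E] [MeasurableSpace E] [BorelSpace E] in
theorem spaceTimePairing_apply (v w : E × ℝ) : spaceTimePairing E v w =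
    -(2 * Real.pi)⁻¹ * (inner ℝ v.1 w.1 + v.2 * w.2) := by
  simp [spaceTimePairing]
  ring

/-- The Fourier integral of `h`, transported to the light cone. -/
noncomputable def coneIntegral (h : E → ℂ) : E × ℝ → ℂ :=
  VectorFourier.fourierIntegral Real.fourierChar (coneMeasure E)
    (spaceTimePairing E).toLinearMap₁₂ (fun v => h v.1)

omit [InnerProductSpace ℝ E] [FiniteDimensional ℝ E] in
theorem measurable_coneMaps : (Measurable fun ξ : E => (ξ, ‖ξ‖)) ∧
    Measurable fun ξ : E => (ξ, -‖ξ‖) := ⟨by fun_prop, by fun_prop⟩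

theorem integrable_coneMeasure {F : Type*} [NormedAddCommGroup F] {k : E × ℝ → F}
    (hk : Continuous k) (h1 : Integrable fun ξ : E => k (ξ, ‖ξ‖))
    (h2 : Integrable fun ξ : E => k (ξ, -‖ξ‖)) : Integrable k (coneMeasure E) := by
  rw [coneMeasure, integrable_add_measure]
  exact ⟨(integrable_map_measure hk.aestronglyMeasurable
      measurable_coneMaps.1.aemeasurable).2 h1,
    (integrable_map_measure hk.aestronglyMeasurable measurable_coneMaps.2.aemeasurable).2 h2⟩

theorem integral_coneMeasure {F : Type*} [NormedAddCommGroup F] [NormedSpace ℝ F]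
    {k : E × ℝ → F} (hk : Continuous k) (h1 : Integrable fun ξ : E => k (ξ, ‖ξ‖))
    (h2 : Integrable fun ξ : E => k (ξ, -‖ξ‖)) :
    ∫ v, k v ∂(coneMeasure E) = ∫ ξ, (k (ξ, ‖ξ‖) + k (ξ, -‖ξ‖)) := by
  have hi := integrable_coneMeasure hk h1 h2
  rw [coneMeasure, integrable_add_measure] at hi
  rw [coneMeasure, integral_add_measure hi.1 hi.2,
    integral_map measurable_coneMaps.1.aemeasurable hk.aestronglyMeasurable,
    integral_map measurable_coneMaps.2.aemeasurable hk.aestronglyMeasurable, integral_add h1 h2]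

theorem ae_coneMeasure : ∀ᵐ v ∂(coneMeasure E), v.2 ^ 2 = ‖v.1‖ ^ 2 := by
  have hm : MeasurableSet {v : E × ℝ | v.2 ^ 2 = ‖v.1‖ ^ 2} :=
    measurableSet_eq_fun (by fun_prop) (by fun_prop)
  rw [coneMeasure, ae_add_measure_iff, ae_map_iff measurable_coneMaps.1.aemeasurable hm,
    ae_map_iff measurable_coneMaps.2.aemeasurable hm]
  constructor <;> exact .of_forall fun ξ => by simp

section

variable {h : E → ℂ} (hcont : Continuous h) (hint : ∀ n : ℕ, Integrable fun ξ => ‖ξ‖ ^ n * ‖h ξ‖)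
include hcont hint

theorem integrable_coneMeasure_moment (n : ℕ) :
    Integrable (fun v : E × ℝ => ‖v‖ ^ n * ‖h v.1‖) (coneMeasure E) := by
  refine integrable_coneMeasure (by fun_prop) ?_ ?_
  · simpa using hint n
  · simpa using hint n

theorem contDiff_coneIntegral : ContDiff ℝ ∞ (coneIntegral h) :=
  VectorFourier.contDiff_fourierIntegral (N := ⊤) (spaceTimePairing E)
    (fun n _ => integrable_coneMeasure_moment hcont hint n)

theorem integrable_of_moments : Integrable h := by
  have := hint 0
  simp only [pow_zero, one_mul] at this
  exact (integrable_norm_iff hcont.aestronglyMeasurable).1 this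

theorem fderiv_fderiv_coneIntegral (w a : E × ℝ) :
    fderiv ℝ (fderiv ℝ (coneIntegral h)) w a a =
      VectorFourier.fourierIntegral Real.fourierChar (coneMeasure E)
        (spaceTimePairing E).toLinearMap₁₂
        (fun v => -(((inner ℝ v.1 a.1 + v.2 * a.2) ^ 2 : ℝ) : ℂ) * h v.1) w := by
  have h1 := VectorFourier.iteratedFDeriv_fourierIntegral (N := ⊤) (spaceTimePairing E)
    (f := fun v : E × ℝ => h v.1) (μ := coneMeasure E)
    (fun n _ => integrable_coneMeasure_moment hcont hint n)
    (hcont.comp continuous_fst).aestronglyMeasurable (n := 2) (by simp)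
  have h2 := congrArg (fun M => M w ![a, a]) h1
  simp only [iteratedFDeriv_two_apply] at h2
  have h3 : (fun v : E × ℝ => -(((inner ℝ v.1 a.1 + v.2 * a.2) ^ 2 : ℝ) : ℂ) * h v.1) =
      fun v => VectorFourier.fourierPowSMulRight (spaceTimePairing E)
        (fun v : E × ℝ => h v.1) v 2 ![a, a] := by
    ext v
    rw [VectorFourier.fourierPowSMulRight_apply]
    simp only [Fin.prod_univ_two, Matrix.cons_val_zero, Matrix.cons_val_one,
      spaceTimePairing_apply, smul_eq_mul, Complex.real_smul]
    push_cast
    have : (Real.pi : ℂ) ≠ 0 := by exact_mod_cast Real.pi_ne_zero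
    field_simp
    linear_combination (-(inner ℝ v.1 a.1 + v.2 * a.2 : ℂ) ^ 2 * h v.1) * Complex.I_sq
  rw [h3]
  have h4 := Real.fourierIntegral_continuousMultilinearMap_apply' (μ := coneMeasure E)
    (L := spaceTimePairing E) (f := fun v => VectorFourier.fourierPowSMulRight
      (spaceTimePairing E) (fun v : E × ℝ => h v.1) v 2) (m := ![a, a]) (w := w)
    (VectorFourier.integrable_fourierPowSMulRight (spaceTimePairing E)
      (integrable_coneMeasure_moment hcont hint 2)
      (hcont.comp continuous_fst).aestronglyMeasurable)
  exact h2.trans h4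

theorem coneIntegral_eq (z : E × ℝ) : coneIntegral h z =
    2 * ∫ ξ, (Real.cos (‖ξ‖ * z.2) : ℂ) * h ξ * Complex.exp (Complex.I * (inner ℝ ξ z.1 : ℝ)) := by
  have h0 := integrable_of_moments hcont hint
  have hexp : ∀ v : E × ℝ, Complex.exp (((-2 * Real.pi * (spaceTimePairing E).toLinearMap₁₂ v z
      : ℝ) : ℂ) * Complex.I) = Complex.exp (Complex.I * ((inner ℝ v.1 z.1 + v.2 * z.2 : ℝ) : ℂ)) := by
    intro v
    change Complex.exp (((-2 * Real.pi * (spaceTimePairing E) v z : ℝ) : ℂ) * Complex.I) = _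
    rw [spaceTimePairing_apply]
    congr 1
    push_cast
    have : (Real.pi : ℂ) ≠ 0 := by exact_mod_cast Real.pi_ne_zero
    field_simp
  rw [coneIntegral, Real.vector_fourierIntegral_eq_integral_exp_smul]
  simp only [hexp, smul_eq_mul]
  have hint' : ∀ g : E → ℝ, Continuous g → Integrable fun ξ : E =>
      Complex.exp (Complex.I * ((inner ℝ ξ z.1 + g ξ * z.2 : ℝ) : ℂ)) * h ξ := fun g hg =>
    h0.bdd_mul (c := 1) (by fun_prop) (.of_forall fun ξ => (norm_exp_I_mul _).le)
  rw [integral_coneMeasure (by fun_prop) (hint' _ (by fun_prop)) (hint' _ (by fun_prop)),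
    ← integral_const_mul]
  refine integral_congr_ae (.of_forall fun ξ => ?_)
  simp only [Complex.ofReal_cos, Complex.cos]
  have e1 : Complex.exp (Complex.I * ((inner ℝ ξ z.1 + ‖ξ‖ * z.2 : ℝ) : ℂ)) =
      Complex.exp (Complex.I * (inner ℝ ξ z.1 : ℝ)) *
        Complex.exp (((‖ξ‖ * z.2 : ℝ) : ℂ) * Complex.I) := by
    rw [← Complex.exp_add]; congr 1; push_cast; ring
  have e2 : Complex.exp (Complex.I * ((inner ℝ ξ z.1 + -‖ξ‖ * z.2 : ℝ) : ℂ)) =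
      Complex.exp (Complex.I * (inner ℝ ξ z.1 : ℝ)) *
        Complex.exp (-((‖ξ‖ * z.2 : ℝ) : ℂ) * Complex.I) := by
    rw [← Complex.exp_add]; congr 1; push_cast; ring
  rw [e1, e2]
  ring

theorem waveSol_eq_coneIntegral (z : E × ℝ) : waveSol h z =
    (((2 * Real.pi : ℝ) ^ Module.finrank ℝ E : ℝ)⁻¹ / 2) * (coneIntegral h z).re := by
  rw [coneIntegral_eq hcont hint, waveSol, fourierInvD, Complex.re_ofReal_mul]
  rw [show (2 : ℂ) = ((2 : ℝ) : ℂ) by norm_num, Complex.re_ofReal_mul]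
  ring

theorem contDiff_waveSol : ContDiff ℝ ∞ (waveSol h) := by
  have : waveSol h = fun z => (((2 * Real.pi : ℝ) ^ Module.finrank ℝ E : ℝ)⁻¹ / 2) *
      (coneIntegral h z).re := funext (waveSol_eq_coneIntegral hcont hint)
  rw [this]
  exact contDiff_const.mul (Complex.reCLM.contDiff.comp (contDiff_coneIntegral hcont hint))

theorem fderiv_fderiv_waveSol (z a : E × ℝ) : fderiv ℝ (fderiv ℝ (waveSol h)) z a a =
    (((2 * Real.pi : ℝ) ^ Module.finrank ℝ E : ℝ)⁻¹ / 2) *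
      (fderiv ℝ (fderiv ℝ (coneIntegral h)) z a a).re := by
  set c : ℝ := ((2 * Real.pi : ℝ) ^ Module.finrank ℝ E : ℝ)⁻¹ / 2
  have h1 : waveSol h = (c • Complex.reCLM) ∘ coneIntegral h := by
    ext z
    simpa using! waveSol_eq_coneIntegral hcont hint z
  have h2 := (c • Complex.reCLM).iteratedFDeriv_comp_left
    (contDiff_coneIntegral hcont hint).contDiffAt (x := z) (i := 2) two_le_infty
  have h3 := congrArg (fun M => M ![a, a]) h2
  rw [← h1] at h3
  simpa [iteratedFDeriv_two_apply] using! h3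

/-- On the light cone `τ² = ‖ξ‖²`, so second derivatives in time and the Laplacian agree under the
Fourier integral. -/
theorem waveSol_wave_equation {ι : Type*} [Fintype ι] (b : OrthonormalBasis ι ℝ E) (z : E × ℝ) :
    fderiv ℝ (fderiv ℝ (waveSol h)) z (0, 1) (0, 1) =
      ∑ i, fderiv ℝ (fderiv ℝ (waveSol h)) z (b i, 0) (b i, 0) := by
  simp only [fderiv_fderiv_waveSol hcont hint]
  rw [← Finset.mul_sum, ← Complex.re_sum]
  congr 2
  simp only [fderiv_fderiv_coneIntegral hcont hint,
    Real.vector_fourierIntegral_eq_integral_exp_smul]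
  rw [← integral_finsetSum]
  · refine integral_congr_ae ?_
    filter_upwards [ae_coneMeasure (E := E)] with v hv
    rw [← Finset.smul_sum, ← Finset.sum_mul]
    congr 2
    simp only [inner_zero_right, mul_one, zero_add, mul_zero, add_zero]
    rw [Finset.sum_neg_distrib, ← Complex.ofReal_sum, hv, ← b.sum_sq_norm_inner_left v.1]
    simp
  · intro i _
    have h1 : Integrable (fun v : E × ℝ =>
        -(((inner ℝ v.1 (b i, (0 : ℝ)).1 + v.2 * (b i, (0 : ℝ)).2) ^ 2 : ℝ) : ℂ) * h v.1)
        (coneMeasure E) := by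
      refine Integrable.mono' (integrable_coneMeasure_moment hcont hint 2)
        (Continuous.aestronglyMeasurable (by fun_prop)) (.of_forall fun v => ?_)
      rw [norm_mul, norm_neg, Complex.norm_real, Real.norm_of_nonneg (by positivity)]
      refine mul_le_mul_of_nonneg_right ?_ (norm_nonneg _)
      simp only [mul_zero, add_zero]
      rw [← sq_abs]
      refine pow_le_pow_left₀ (abs_nonneg _) ?_ 2
      refine (abs_real_inner_le_norm _ _).trans ?_
      simp only [OrthonormalBasis.norm_eq_one, mul_one]
      exact norm_fst_le v
    refine h1.bdd_mul (c := 1) (Continuous.aestronglyMeasurable ?_) (.of_forall fun v => ?_)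
    · have : Continuous fun v => (spaceTimePairing E) v z := by fun_prop
      exact Complex.continuous_exp.comp ((Complex.continuous_ofReal.comp
        (continuous_const.mul this)).mul continuous_const)
    · rw [Complex.norm_exp]; simp

/-- Existence for the wave equation: the Fourier integral `waveSol h` solves the initial value
problem. -/
theorem isWaveSolution_waveSol {f : E → ℝ} (hf : ∀ x, (f x : ℂ) = fourierInvD h x) :
    IsWaveSolution f (waveSol h) := by
  have hsm := contDiff_waveSol hcont hint
  refine ⟨hsm.contDiffOn, fun x t _ => ?_, fun x => ?_, fun x => ?_⟩
  · have hC : ContDiffAt ℝ 2 (waveSol h) (x, t) := hsm.contDiffAt.of_le two_le_infty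
    rw [iteratedDeriv_two_time_slice hC, laplacian_space_slice (stdOrthonormalBasis ℝ E) hC,
      waveSol_wave_equation hcont hint (stdOrthonormalBasis ℝ E), sub_self]
  · simp [waveSol, ← hf]
  · have hd : DifferentiableAt ℝ (fun τ => waveSol h (x, τ)) 0 :=
      (hsm.comp (contDiff_prodMk_right x)).differentiable (by simp) 0
    have heven : Function.Even (fun τ => waveSol h (x, τ)) := fun τ => by simp [waveSol]
    have h0 : deriv (fun τ => waveSol h (x, τ)) 0 = 0 := by
      have := deriv_comp_neg (fun τ => waveSol h (x, τ)) 0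
      simp only [heven _, neg_zero] at this
      linarith
    have := hd.hasDerivAt
    rw [h0] at this
    exact this.hasDerivWithinAt

end

end WaveExistence

/-! ### Integrals of compactly supported slices -/

section CompactlySupportedSlices

variable {E : Type*} [NormedAddCommGroup E] [InnerProductSpace ℝ E] [FiniteDimensional ℝ E]
  [MeasurableSpace E] [BorelSpace E] {K : E × ℝ → ℝ} {T : ℝ} {k : Set E}

/-- The slab `E × (0, T)`. -/
def slab (E : Type*) (T : ℝ) : Set (E × ℝ) := univ ×ˢ Ioo 0 T

omit [InnerProductSpace ℝ E] [FiniteDimensional ℝ E] [MeasurableSpace E] [BorelSpace E] in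
theorem isOpen_slab : IsOpen (slab E T) := isOpen_univ.prod isOpen_Ioo

variable (hK : ContDiffOn ℝ 1 K (slab E T)) (hk : IsCompact k)
  (hK0 : ∀ x t, t ∈ Ioo 0 T → x ∉ k → K (x, t) = 0)
include hK hk hK0

omit [FiniteDimensional ℝ E] [MeasurableSpace E] [BorelSpace E] hK in
theorem fderiv_eq_zero_of_support {x : E} {t : ℝ} (ht : t ∈ Ioo 0 T) (hx : x ∉ k) :
    fderiv ℝ K (x, t) = 0 := by
  have hev : K =ᶠ[𝓝 (x, t)] fun _ => 0 := by
    have hmem : kᶜ ×ˢ Ioo 0 T ∈ 𝓝 (x, t) :=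
      (hk.isClosed.isOpen_compl.prod isOpen_Ioo).mem_nhds ⟨hx, ht⟩
    filter_upwards [hmem] with z hz using hK0 z.1 z.2 hz.2 hz.1
  rw [hev.fderiv_eq, fderiv_fun_const]
  rfl

omit [FiniteDimensional ℝ E] [MeasurableSpace E] [BorelSpace E] hk hK0 in
theorem continuousOn_fderiv_slab (a : E × ℝ) :
    ContinuousOn (fun z => fderiv ℝ K z a) (slab E T) :=
  ((hK.continuousOn_fderiv_of_isOpen isOpen_slab le_rfl).clm_apply continuousOn_const)

theorem integrable_fderiv_slice (a : E × ℝ) {t : ℝ} (ht : t ∈ Ioo 0 T) :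
    Integrable fun x => fderiv ℝ K (x, t) a := by
  have hcont : Continuous fun x => fderiv ℝ K (x, t) a :=
    (continuousOn_fderiv_slab hK a).comp_continuous (by fun_prop)
      fun x => ⟨mem_univ _, ht⟩
  refine hcont.integrable_of_hasCompactSupport (HasCompactSupport.intro hk fun x hx => ?_)
  rw [fderiv_eq_zero_of_support hk hK0 ht hx]
  rfl

theorem integral_fderiv_space_eq_zero (a : E) {t : ℝ} (ht : t ∈ Ioo 0 T) :
    ∫ x, fderiv ℝ K (x, t) (a, 0) = 0 := by
  have hd : ∀ x, HasFDerivAt (fun y => K (y, t))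
      ((fderiv ℝ K (x, t)).comp (ContinuousLinearMap.inl ℝ E ℝ)) x := fun x => by
    have h1 : DifferentiableAt ℝ K (x, t) :=
      ((hK.contDiffAt (isOpen_slab.mem_nhds ⟨mem_univ _, ht⟩)).differentiableAt (by simp))
    exact h1.hasFDerivAt.comp x (hasFDerivAt_prodMk_left x t)
  have hc : Continuous fun y => K (y, t) :=
    continuous_iff_continuousAt.2 fun x => (hd x).continuousAt
  have h2 := integral_mul_fderiv_eq_neg_fderiv_mul_of_integrable (μ := (volume : Measure E))
    (f := fun _ : E => (1 : ℝ)) (g := fun y => K (y, t)) (v := a) (by simp)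
    (by simpa [(hd _).fderiv] using! integrable_fderiv_slice hK hk hK0 (a, 0) ht)
    (by simpa using hc.integrable_of_hasCompactSupport (HasCompactSupport.intro hk
      fun x hx => hK0 x t ht hx)) (by fun_prop) (fun x _ => (hd x).differentiableAt)
  simpa [(hd _).fderiv] using! h2

theorem hasDerivAt_integral_slice {t : ℝ} (ht : t ∈ Ioo 0 T) :
    HasDerivAt (fun τ => ∫ x, K (x, τ)) (∫ x, fderiv ℝ K (x, t) (0, 1)) t := by
  obtain ⟨δ, hδ, hδs⟩ := Metric.nhds_basis_closedBall.mem_iff.1 (isOpen_Ioo.mem_nhds ht)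
  have hcpt : IsCompact (k ×ˢ Metric.closedBall t δ) := hk.prod (isCompact_closedBall t δ)
  obtain ⟨M, hM⟩ := (hcpt.image_of_continuousOn ((continuousOn_fderiv_slab hK (0, 1)).mono
    fun z hz => ⟨mem_univ _, hδs hz.2⟩)).isBounded.exists_norm_le
  have hslice : ∀ τ ∈ Ioo 0 T, Continuous fun x => K (x, τ) := fun τ hτ =>
    hK.continuousOn.comp_continuous (by fun_prop) fun x => ⟨mem_univ _, hτ⟩
  refine (hasDerivAt_integral_of_dominated_loc_of_deriv_le (μ := (volume : Measure E))
    (F := fun τ x => K (x, τ)) (F' := fun τ x => fderiv ℝ K (x, τ) (0, 1))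
    (bound := k.indicator fun _ => M) (Metric.closedBall_mem_nhds t hδ) ?_ ?_ ?_ ?_ ?_ ?_).2
  · filter_upwards [isOpen_Ioo.mem_nhds ht] with τ hτ using (hslice τ hτ).aestronglyMeasurable
  · exact (hslice t ht).integrable_of_hasCompactSupport
      (HasCompactSupport.intro hk fun x hx => hK0 x t ht hx)
  · exact (integrable_fderiv_slice hK hk hK0 _ ht).1
  · refine .of_forall fun x τ hτ => ?_
    by_cases hx : x ∈ k
    · rw [indicator_of_mem hx]
      exact hM _ ⟨(x, τ), ⟨hx, hτ⟩, rfl⟩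
    · rw [indicator_of_notMem hx, fderiv_eq_zero_of_support hk hK0 (hδs hτ) hx]
      simp
  · exact (integrable_indicator_iff hk.measurableSet).2 (integrableOn_const hk.measure_ne_top)
  · refine .of_forall fun x τ hτ => ?_
    have h1 : DifferentiableAt ℝ K (x, τ) :=
      ((hK.contDiffAt (isOpen_slab.mem_nhds ⟨mem_univ _, hδs hτ⟩)).differentiableAt (by simp))
    have h2 := h1.hasFDerivAt.comp_hasDerivAt τ
      ((hasDerivAt_const τ x).prodMk (hasDerivAt_id τ))
    exact h2

end CompactlySupportedSlices

/-! ### Uniqueness for the wave equation by the energy method -/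

section EnergyMethod

variable {E : Type*} [NormedAddCommGroup E] [InnerProductSpace ℝ E] [FiniteDimensional ℝ E]

omit [FiniteDimensional ℝ E] in
theorem uniqueDiffOn_halfSpace : UniqueDiffOn ℝ (halfSpace E) :=
  uniqueDiffOn_univ.prod (uniqueDiffOn_Ici 0)

omit [InnerProductSpace ℝ E] [FiniteDimensional ℝ E] in
theorem halfSpace_mem_nhds {x : E} {t : ℝ} (ht : 0 < t) : halfSpace E ∈ 𝓝 (x, t) :=
  prod_mem_nhds univ_mem (Ici_mem_nhds ht)

/-- The difference of two solutions solves the problem with zero initial data. -/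
theorem IsWaveSolution.sub {f : E → ℝ} {p q : E × ℝ → ℝ} (hp : IsWaveSolution f p)
    (hq : IsWaveSolution f q) : IsWaveSolution (fun _ => 0) (q - p) := by
  refine ⟨hq.smooth.sub hp.smooth, fun x t ht => ?_, fun x => ?_, fun x => ?_⟩
  · have hpc : ContDiffAt ℝ 2 p (x, t) :=
      (hp.smooth.contDiffAt (halfSpace_mem_nhds ht)).of_le two_le_infty
    have hqc : ContDiffAt ℝ 2 q (x, t) :=
      (hq.smooth.contDiffAt (halfSpace_mem_nhds ht)).of_le two_le_infty
    have h1 : iteratedDeriv 2 ((fun τ => q (x, τ)) - fun τ => p (x, τ)) t =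
        iteratedDeriv 2 (fun τ => q (x, τ)) t - iteratedDeriv 2 (fun τ => p (x, τ)) t :=
      iteratedDeriv_sub (hqc.comp t (contDiff_prodMk_right x).contDiffAt)
        (hpc.comp t (contDiff_prodMk_right x).contDiffAt)
    have h2 : Δ ((fun y => q (y, t)) - fun y => p (y, t)) x =
        Δ (fun y => q (y, t)) x - Δ (fun y => p (y, t)) x :=
      ContDiffAt.laplacian_sub (hqc.comp x (contDiff_prodMk_left t).contDiffAt)
        (hpc.comp x (contDiff_prodMk_left t).contDiffAt)
    change iteratedDeriv 2 ((fun τ => q (x, τ)) - fun τ => p (x, τ)) t -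
      Δ ((fun y => q (y, t)) - fun y => p (y, t)) x = 0
    rw [h1, h2]
    linear_combination hq.wave x t ht - hp.wave x t ht
  · simp [hp.initial, hq.initial]
  · simpa using! (hq.initial_deriv x).sub (hp.initial_deriv x)

/-- The gradient of a solution with zero initial data vanishes at time `0`. -/
theorem IsWaveSolution.fderivWithin_zero {w : E × ℝ → ℝ} (hw : IsWaveSolution (fun _ => 0) w)
    (x : E) : fderivWithin ℝ w (halfSpace E) (x, 0) = 0 := by
  have hmem : (x, (0 : ℝ)) ∈ halfSpace E := ⟨mem_univ _, mem_Ici.2 le_rfl⟩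
  have hd := ((hw.smooth.differentiableOn (by simp)) _ hmem).hasFDerivWithinAt
  have h1 : fderivWithin ℝ w (halfSpace E) (x, 0) (0, 1) = 0 := by
    have h2 : HasDerivWithinAt (fun τ => w (x, τ))
        (fderivWithin ℝ w (halfSpace E) (x, 0) (0, 1)) (Ici 0) 0 :=
      hd.comp_hasDerivWithinAt (f := fun τ : ℝ => (x, τ)) (f' := ((0 : E), (1 : ℝ))) 0
        (((hasDerivAt_const (0 : ℝ) x).prodMk (hasDerivAt_id (0 : ℝ))).hasDerivWithinAt)
        fun τ hτ => ⟨mem_univ _, hτ⟩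
    exact (uniqueDiffWithinAt_Ici 0).eq_deriv _ h2 (hw.initial_deriv x)
  have h3 : ∀ y : E, fderivWithin ℝ w (halfSpace E) (x, 0) (y, 0) = 0 := by
    intro y
    have h4 : HasFDerivAt (fun y => w (y, (0 : ℝ)))
        ((fderivWithin ℝ w (halfSpace E) (x, 0)).comp (ContinuousLinearMap.inl ℝ E ℝ)) x := by
      rw [← hasFDerivWithinAt_univ]
      have hmaps : MapsTo (fun y : E => (y, (0 : ℝ))) univ (halfSpace E) :=
        fun z _ => ⟨mem_univ _, mem_Ici.2 le_rfl⟩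
      exact hd.comp x (hasFDerivAt_prodMk_left x (0 : ℝ)).hasFDerivWithinAt hmaps
    have h5 : (fun y => w (y, (0 : ℝ))) = fun _ => 0 := funext hw.initial
    rw [h5] at h4
    have h6 := h4.unique (hasFDerivAt_const (0 : ℝ) x)
    simpa using! congrArg (fun M => M y) h6
  ext a
  · simpa using! h3 a
  · simpa using! h1

/-- The weight `θ((T - t)² - ‖x - x₀‖²)` with `θ(s) = exp(-1/s)` for `s > 0` and `θ(s) = 0`
otherwise: for `t ≤ T`, a smooth cutoff to the backward light cone with vertex `(x₀, T)`. -/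
noncomputable def coneWeight (x₀ : E) (T : ℝ) : E × ℝ → ℝ := fun z =>
  expNegInvGlue ((T - z.2) ^ 2 - ‖z.1 - x₀‖ ^ 2)

/-- The energy density `w_t² + |∇w|²` in an orthonormal basis, from the derivative `D` of `w`. -/
noncomputable def energyDensity {ι : Type*} [Fintype ι] (b : OrthonormalBasis ι ℝ E)
    (D : E × ℝ →L[ℝ] ℝ) : ℝ := D (0, 1) ^ 2 + ∑ i, D (b i, 0) ^ 2

omit [FiniteDimensional ℝ E] in
theorem contDiff_coneWeight (x₀ : E) (T : ℝ) : ContDiff ℝ 1 (coneWeight x₀ T) := by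
  have h : ContDiff ℝ (1 : ℕ∞) expNegInvGlue := expNegInvGlue.contDiff
  exact h.comp (((contDiff_const.sub contDiff_snd).pow 2).sub
    ((contDiff_fst.sub contDiff_const).norm_sq ℝ))

theorem deriv_expNegInvGlue_nonneg (s : ℝ) : 0 ≤ deriv expNegInvGlue s :=
  expNegInvGlue.monotone.deriv_nonneg

theorem deriv_expNegInvGlue_of_nonpos {s : ℝ} (hs : s ≤ 0) : deriv expNegInvGlue s = 0 := by
  have : IsLocalMin expNegInvGlue s := .of_forall fun y => by
    rw [expNegInvGlue.zero_of_nonpos hs]; exact expNegInvGlue.nonneg y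
  exact this.deriv_eq_zero

omit [FiniteDimensional ℝ E] in
theorem fderiv_coneWeight (x₀ : E) (T : ℝ) (z a : E × ℝ) : fderiv ℝ (coneWeight x₀ T) z a =
    deriv expNegInvGlue ((T - z.2) ^ 2 - ‖z.1 - x₀‖ ^ 2) *
      (-2 * (T - z.2) * a.2 - 2 * inner ℝ (z.1 - x₀) a.1) := by
  have h : ContDiff ℝ (1 : ℕ∞) expNegInvGlue := expNegInvGlue.contDiff
  have h1 := (h.differentiable (by simp) ((T - z.2) ^ 2 - ‖z.1 - x₀‖ ^ 2)).hasDerivAt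
  have h2 : HasFDerivAt (fun z : E × ℝ => (T - z.2) ^ 2 - ‖z.1 - x₀‖ ^ 2) _ z :=
    (((hasFDerivAt_snd (𝕜 := ℝ) (p := z)).const_sub T).pow 2).sub
      ((hasFDerivAt_fst (𝕜 := ℝ) (p := z)).sub_const x₀).norm_sq
  have h3 := h1.comp_hasFDerivAt z h2
  change HasFDerivAt (coneWeight x₀ T) _ z at h3
  rw [h3.fderiv]
  simp [inner_sub_left]

/-- The quadratic form behind the domain of dependence: inside the light cone `‖y‖ ≤ τ`, the
gradient of the weight is timelike, and the energy flux against it has a sign. -/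
theorem energy_flux_nonneg {ι : Type*} [Fintype ι] {τ a : ℝ} {y g : ι → ℝ} (hτ : 0 < τ)
    (hy : ∑ i, y i ^ 2 ≤ τ ^ 2) :
    0 ≤ τ * (a ^ 2 + ∑ i, g i ^ 2) - 2 * ∑ i, y i * a * g i := by
  have h : τ * (τ * (a ^ 2 + ∑ i, g i ^ 2) - 2 * ∑ i, y i * a * g i) =
      ∑ i, (τ * g i - y i * a) ^ 2 + a ^ 2 * (τ ^ 2 - ∑ i, y i ^ 2) := by
    have : ∑ i, (τ * g i - y i * a) ^ 2 =
        τ ^ 2 * ∑ i, g i ^ 2 - 2 * τ * ∑ i, y i * a * g i + a ^ 2 * ∑ i, y i ^ 2 := by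
      simp only [Finset.mul_sum, ← Finset.sum_sub_distrib, ← Finset.sum_add_distrib]
      exact Finset.sum_congr rfl fun i _ => by ring
    rw [this]; ring
  have h2 : 0 ≤ τ * (τ * (a ^ 2 + ∑ i, g i ^ 2) - 2 * ∑ i, y i * a * g i) := by
    rw [h]
    have := Finset.sum_nonneg fun i (_ : i ∈ Finset.univ) => sq_nonneg (τ * g i - y i * a)
    have := mul_nonneg (sq_nonneg a) (sub_nonneg.2 hy)
    linarith
  exact nonneg_of_mul_nonneg_right h2 hτ

section Identity

variable {w : E × ℝ → ℝ} (hw : IsWaveSolution (fun _ => 0) w)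
include hw

theorem IsWaveSolution.contDiffOn_fderivWithin :
    ContDiffOn ℝ 1 (fderivWithin ℝ w (halfSpace E)) (halfSpace E) :=
  hw.smooth.fderivWithin uniqueDiffOn_halfSpace two_le_infty

theorem IsWaveSolution.fderiv_fderivWithin_symm {x : E} {t : ℝ} (ht : 0 < t) (a c : E × ℝ) :
    fderiv ℝ (fderivWithin ℝ w (halfSpace E)) (x, t) a c =
      fderiv ℝ (fderivWithin ℝ w (halfSpace E)) (x, t) c a := by
  have hev : fderivWithin ℝ w (halfSpace E) =ᶠ[𝓝 (x, t)] fderiv ℝ w := by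
    filter_upwards [eventually_mem_nhds_iff.2 (halfSpace_mem_nhds (x := x) ht)] with z hz
      using fderivWithin_of_mem_nhds hz
  rw [hev.fderiv_eq]
  have hwc : ContDiffAt ℝ 2 w (x, t) :=
    (hw.smooth.contDiffAt (halfSpace_mem_nhds ht)).of_le two_le_infty
  exact (hwc.isSymmSndFDerivAt (by simp)).eq a c

theorem IsWaveSolution.fderiv_fderivWithin_wave {ι : Type*} [Fintype ι]
    (b : OrthonormalBasis ι ℝ E) {x : E} {t : ℝ} (ht : 0 < t) :
    fderiv ℝ (fderivWithin ℝ w (halfSpace E)) (x, t) (0, 1) (0, 1) =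
      ∑ i, fderiv ℝ (fderivWithin ℝ w (halfSpace E)) (x, t) (b i, 0) (b i, 0) := by
  have hev : fderivWithin ℝ w (halfSpace E) =ᶠ[𝓝 (x, t)] fderiv ℝ w := by
    filter_upwards [eventually_mem_nhds_iff.2 (halfSpace_mem_nhds (x := x) ht)] with z hz
      using fderivWithin_of_mem_nhds hz
  rw [hev.fderiv_eq]
  have hwc : ContDiffAt ℝ 2 w (x, t) :=
    (hw.smooth.contDiffAt (halfSpace_mem_nhds ht)).of_le two_le_infty
  have := hw.wave x t ht
  rwa [iteratedDeriv_two_time_slice hwc, laplacian_space_slice b hwc, sub_eq_zero] at this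

/-- The weighted energy inequality in differential form: up to the divergence of
`2 θ w_t ∇w`, the time derivative of the weighted energy density is nonpositive. -/
theorem IsWaveSolution.energy_inequality {ι : Type*} [Fintype ι] (b : OrthonormalBasis ι ℝ E)
    (x₀ x : E) {t T : ℝ} (ht : t ∈ Ioo 0 T) :
    fderiv ℝ (fun z => coneWeight x₀ T z *
        energyDensity b (fderivWithin ℝ w (halfSpace E) z)) (x, t) (0, 1) -
      2 * ∑ i, fderiv ℝ (fun z => coneWeight x₀ T z *
        (fderivWithin ℝ w (halfSpace E) z (0, 1) * fderivWithin ℝ w (halfSpace E) z (b i, 0)))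
        (x, t) (b i, 0) ≤ 0 := by
  set D := fderivWithin ℝ w (halfSpace E) with hD
  set ψ := coneWeight x₀ T with hψ
  set z : E × ℝ := (x, t) with hz
  have hDd : HasFDerivAt D (fderiv ℝ D z) z :=
    ((hw.contDiffOn_fderivWithin.contDiffAt (halfSpace_mem_nhds ht.1)).differentiableAt
      (by simp)).hasFDerivAt
  have hψd : HasFDerivAt ψ (fderiv ℝ ψ z) z :=
    ((contDiff_coneWeight x₀ T).differentiable (by simp) z).hasFDerivAt
  have hDa : ∀ a, HasFDerivAt (fun z => D z a) ((fderiv ℝ D z).flip a) z := fun a => by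
    have := hDd.clm_apply (hasFDerivAt_const a z)
    simpa using this
  have hF : fderiv ℝ (fun z => ψ z * energyDensity b (D z)) z (0, 1) =
      ψ z * (2 * D z (0, 1) * fderiv ℝ D z (0, 1) (0, 1) +
        ∑ i, 2 * D z (b i, 0) * fderiv ℝ D z (0, 1) (b i, 0)) +
      energyDensity b (D z) * fderiv ℝ ψ z (0, 1) := by
    have h1 := hψd.mul (((hDa (0, 1)).pow 2).add
      (HasFDerivAt.fun_sum (u := Finset.univ) fun i _ => (hDa (b i, 0)).pow 2))
    have h2 := h1.fderiv
    change fderiv ℝ (fun z => ψ z * energyDensity b (D z)) z = _ at h2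
    rw [h2]
    simp [energyDensity, mul_add]
  have hG : ∀ i, fderiv ℝ (fun z => ψ z * (D z (0, 1) * D z (b i, 0))) z (b i, 0) =
      ψ z * (D z (0, 1) * fderiv ℝ D z (b i, 0) (b i, 0) +
        D z (b i, 0) * fderiv ℝ D z (b i, 0) (0, 1)) +
      D z (0, 1) * D z (b i, 0) * fderiv ℝ ψ z (b i, 0) := by
    intro i
    have h1 := hψd.mul ((hDa (0, 1)).mul (hDa (b i, 0)))
    have h2 := h1.fderiv
    change fderiv ℝ (fun z => ψ z * (D z (0, 1) * D z (b i, 0))) z = _ at h2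
    rw [h2]
    simp [mul_add]
  have hsymm : ∀ i, fderiv ℝ D z (b i, 0) (0, 1) = fderiv ℝ D z (0, 1) (b i, 0) := fun i =>
    hw.fderiv_fderivWithin_symm ht.1 _ _
  have hwave := hw.fderiv_fderivWithin_wave b (x := x) ht.1
  rw [← hD, ← hz] at hwave
  simp only [hG, hsymm]
  rw [hF, hwave]
  have hkey : ψ z * (2 * D z (0, 1) * ∑ i, fderiv ℝ D z (b i, 0) (b i, 0) +
        ∑ i, 2 * D z (b i, 0) * fderiv ℝ D z (0, 1) (b i, 0)) +
      energyDensity b (D z) * fderiv ℝ ψ z (0, 1) -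
      2 * ∑ i, (ψ z * (D z (0, 1) * fderiv ℝ D z (b i, 0) (b i, 0) +
        D z (b i, 0) * fderiv ℝ D z (0, 1) (b i, 0)) +
      D z (0, 1) * D z (b i, 0) * fderiv ℝ ψ z (b i, 0)) =
      energyDensity b (D z) * fderiv ℝ ψ z (0, 1) -
        2 * ∑ i, D z (0, 1) * D z (b i, 0) * fderiv ℝ ψ z (b i, 0) := by
    have h1 : ψ z * (2 * D z (0, 1) * ∑ i, fderiv ℝ D z (b i, 0) (b i, 0) +
        ∑ i, 2 * D z (b i, 0) * fderiv ℝ D z (0, 1) (b i, 0)) =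
        2 * ∑ i, ψ z * (D z (0, 1) * fderiv ℝ D z (b i, 0) (b i, 0) +
        D z (b i, 0) * fderiv ℝ D z (0, 1) (b i, 0)) := by
      simp only [Finset.mul_sum, ← Finset.sum_add_distrib]
      exact Finset.sum_congr rfl fun i _ => by ring
    rw [h1, Finset.sum_add_distrib]; ring
  rw [hkey]
  simp only [hψ, fderiv_coneWeight]
  set s := (T - z.2) ^ 2 - ‖z.1 - x₀‖ ^ 2 with hs
  have hfact : energyDensity b (D z) * (deriv expNegInvGlue s * (-2 * (T - z.2) * 1 -
        2 * inner ℝ (z.1 - x₀) 0)) - 2 * ∑ i, D z (0, 1) * D z (b i, 0) *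
        (deriv expNegInvGlue s * (-2 * (T - z.2) * 0 - 2 * inner ℝ (z.1 - x₀) (b i))) =
      -(2 * deriv expNegInvGlue s * ((T - t) * (D z (0, 1) ^ 2 + ∑ i, D z (b i, 0) ^ 2) -
        2 * ∑ i, inner ℝ (z.1 - x₀) (b i) * D z (0, 1) * D z (b i, 0))) := by
    have h1 : ∑ i, D z (0, 1) * D z (b i, 0) *
        (deriv expNegInvGlue s * (-2 * (T - z.2) * 0 - 2 * inner ℝ (z.1 - x₀) (b i))) =
        -2 * deriv expNegInvGlue s *
          ∑ i, inner ℝ (z.1 - x₀) (b i) * D z (0, 1) * D z (b i, 0) := by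
      simp only [Finset.mul_sum]
      exact Finset.sum_congr rfl fun i _ => by ring
    rw [h1, inner_zero_right, energyDensity]
    ring
  refine hfact.trans_le ?_
  rw [neg_nonpos]
  rcases le_or_gt s 0 with hs0 | hs0
  · rw [deriv_expNegInvGlue_of_nonpos hs0]; simp
  · refine mul_nonneg (mul_nonneg two_pos.le (deriv_expNegInvGlue_nonneg s)) ?_
    refine energy_flux_nonneg (sub_pos.2 ht.2) ?_
    have h1 := b.sum_sq_norm_inner_left (z.1 - x₀)
    simp only [Real.norm_eq_abs, sq_abs] at h1
    rw [h1]
    simp only [hs, hz] at hs0 ⊢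
    linarith

end Identity

variable [MeasurableSpace E] [BorelSpace E]

/-- A solution with vanishing initial data has vanishing time derivative at every positive time: its
weighted energy in a backward light cone containing the point is nonincreasing and starts at `0`. -/
theorem IsWaveSolution.fderivWithin_time_eq_zero {w : E × ℝ → ℝ}
    (hw : IsWaveSolution (fun _ => 0) w) (x₀ : E) {t₁ : ℝ} (ht₁ : 0 < t₁) :
    fderivWithin ℝ w (halfSpace E) (x₀, t₁) (0, 1) = 0 := by
  set D := fderivWithin ℝ w (halfSpace E) with hD
  set b := stdOrthonormalBasis ℝ E
  -- the vertex of the cone lies above `t₁`, so that the weight is positive at `(x₀, t₁)`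
  set T : ℝ := t₁ + 1 with hT
  set ψ := coneWeight x₀ T with hψ
  set F : E × ℝ → ℝ := fun z => ψ z * energyDensity b (D z) with hF
  have hDc : ContDiffOn ℝ 1 D (halfSpace E) := hw.contDiffOn_fderivWithin
  have hDa : ∀ a, ContDiffOn ℝ 1 (fun z => D z a) (halfSpace E) := fun a =>
    hDc.clm_apply contDiffOn_const
  have hψc : ContDiff ℝ 1 ψ := contDiff_coneWeight x₀ T
  have hFc : ContDiffOn ℝ 1 F (halfSpace E) :=
    hψc.contDiffOn.mul (((hDa _).pow 2).add (ContDiffOn.sum fun i _ => (hDa _).pow 2))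
  have hGc : ∀ i, ContDiffOn ℝ 1 (fun z => ψ z * (D z (0, 1) * D z (b i, 0))) (halfSpace E) :=
    fun i => hψc.contDiffOn.mul ((hDa _).mul (hDa _))
  have hsub : slab E T ⊆ halfSpace E := fun z hz => ⟨mem_univ _, hz.2.1.le⟩
  set k := Metric.closedBall x₀ T with hk
  have hkc : IsCompact k := isCompact_closedBall x₀ T
  have hψ0 : ∀ x t, t ∈ Icc 0 T → x ∉ k → ψ (x, t) = 0 := by
    intro x t ht hx
    refine expNegInvGlue.zero_of_nonpos ?_
    simp only [hk, Metric.mem_closedBall, dist_eq_norm, not_le] at hx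
    have h1 := ht.1
    have h2 := ht.2
    simp only
    nlinarith
  have hE0 : ∀ x, F (x, 0) = 0 := fun x => by
    simp only [hF, hD, hw.fderivWithin_zero, energyDensity]
    simp
  have hcont : ContinuousOn (fun t => ∫ x, F (x, t)) (Icc 0 t₁) := by
    refine continuousOn_integral_of_compact_support (f := fun t x => F (x, t)) hkc ?_ ?_
    · exact hFc.continuousOn.comp (by fun_prop) fun z hz => ⟨mem_univ _, hz.1.1⟩
    · intro t x ht hx
      simp only [hF, hψ0 x t ⟨ht.1, ht.2.trans (by linarith)⟩ hx, zero_mul]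
  have hIoo : ∀ t ∈ Ioo 0 t₁, t ∈ Ioo 0 T := fun t ht => ⟨ht.1, ht.2.trans (by linarith)⟩
  have hF0 : ∀ x t, t ∈ Ioo 0 T → x ∉ k → F (x, t) = 0 := fun x t ht hx => by
    simp only [hF, hψ0 x t ⟨ht.1.le, ht.2.le⟩ hx, zero_mul]
  have hder : ∀ t ∈ Ioo 0 t₁, HasDerivAt (fun t => ∫ x, F (x, t))
      (∫ x, fderiv ℝ F (x, t) (0, 1)) t := fun t ht =>
    hasDerivAt_integral_slice (hFc.mono hsub) hkc hF0 (hIoo t ht)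
  have hle : ∀ t ∈ Ioo 0 t₁, ∫ x, fderiv ℝ F (x, t) (0, 1) ≤ 0 := by
    intro t ht
    have hG0 : ∀ i, ∀ x t, t ∈ Ioo 0 T → x ∉ k → ψ (x, t) *
        (D (x, t) (0, 1) * D (x, t) (b i, 0)) = 0 := fun i x t ht hx => by
      simp only [hψ0 x t ⟨ht.1.le, ht.2.le⟩ hx, zero_mul]
    have h1 : ∫ x, 2 * ∑ i, fderiv ℝ (fun z => ψ z * (D z (0, 1) * D z (b i, 0)))
        (x, t) (b i, 0) = 0 := by
      rw [integral_const_mul, integral_finsetSum _ fun i _ =>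
        integrable_fderiv_slice ((hGc i).mono hsub) hkc (hG0 i) _ (hIoo t ht)]
      simp only [integral_fderiv_space_eq_zero ((hGc _).mono hsub) hkc (hG0 _) _ (hIoo t ht)]
      simp
    have h2 : ∫ x, fderiv ℝ F (x, t) (0, 1) = ∫ x, (fderiv ℝ F (x, t) (0, 1) -
        2 * ∑ i, fderiv ℝ (fun z => ψ z * (D z (0, 1) * D z (b i, 0))) (x, t) (b i, 0)) := by
      rw [integral_sub, h1, sub_zero]
      · exact integrable_fderiv_slice (hFc.mono hsub) hkc hF0 _ (hIoo t ht)
      · exact (integrable_finsetSum _ fun i _ =>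
          integrable_fderiv_slice ((hGc i).mono hsub) hkc (hG0 i) _ (hIoo t ht)).const_mul _
    rw [h2]
    exact integral_nonpos fun x => hw.energy_inequality b x₀ x (hIoo t ht)
  have hanti : AntitoneOn (fun t => ∫ x, F (x, t)) (Icc 0 t₁) := by
    refine antitoneOn_of_deriv_nonpos (convex_Icc _ _) hcont ?_ ?_
    · rw [interior_Icc]
      exact fun t ht => (hder t ht).differentiableAt.differentiableWithinAt
    · rw [interior_Icc]
      exact fun t ht => (hder t ht).deriv.trans_le (hle t ht)
  have hmem : (t₁ : ℝ) ∈ Icc 0 t₁ := ⟨ht₁.le, le_rfl⟩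
  have hen : ∫ x, F (x, t₁) ≤ 0 := by
    have := hanti ⟨le_rfl, ht₁.le⟩ hmem ht₁.le
    simpa [hE0] using this
  have hnn : ∀ z, 0 ≤ F z := fun z => mul_nonneg (expNegInvGlue.nonneg _)
    (add_nonneg (sq_nonneg _) (Finset.sum_nonneg fun i _ => sq_nonneg _))
  have hsl : Continuous fun x => F (x, t₁) :=
    hFc.continuousOn.comp_continuous (by fun_prop) fun x => ⟨mem_univ _, ht₁.le⟩
  have hzero : F (x₀, t₁) = 0 := by
    by_contra hne
    have hpos := hsl.integral_pos_of_hasCompactSupport_nonneg_nonzero (μ := volume)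
      (HasCompactSupport.intro hkc fun x hx => hF0 x t₁ ⟨ht₁, by linarith⟩ hx)
      (fun x => hnn _) hne
    linarith
  have hψpos : 0 < ψ (x₀, t₁) := by
    refine expNegInvGlue.pos_of_pos ?_
    simp [hT]
  have h1 : energyDensity b (D (x₀, t₁)) = 0 := by
    rcases mul_eq_zero.1 hzero with h | h
    · exact absurd h hψpos.ne'
    · exact h
  have h2 : 0 ≤ ∑ i, D (x₀, t₁) (b i, 0) ^ 2 := Finset.sum_nonneg fun i _ => sq_nonneg _
  rw [energyDensity] at h1
  have h3 : D (x₀, t₁) (0, 1) ^ 2 = 0 := le_antisymm (by linarith) (sq_nonneg _)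
  exact pow_eq_zero_iff (two_ne_zero) |>.1 h3

theorem IsWaveSolution.eq_zero {w : E × ℝ → ℝ} (hw : IsWaveSolution (fun _ => 0) w) {z : E × ℝ}
    (hz : z ∈ halfSpace E) : w z = 0 := by
  obtain ⟨x, t⟩ := z
  have ht : 0 ≤ t := hz.2
  have hcont : ContinuousOn (fun τ => w (x, τ)) (Icc 0 t) :=
    hw.smooth.continuousOn.comp (by fun_prop) fun τ hτ => ⟨mem_univ _, hτ.1⟩
  have hder : ∀ τ ∈ Ico 0 t, HasDerivWithinAt (fun τ => w (x, τ)) 0 (Ici τ) τ := by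
    intro τ hτ
    rcases hτ.1.eq_or_lt with h | h
    · rw [← h]; exact hw.initial_deriv x
    · have hd := ((hw.smooth.differentiableOn (by simp)) (x, τ)
        ⟨mem_univ _, hτ.1⟩).hasFDerivWithinAt
      have h2 : HasDerivWithinAt (fun τ => w (x, τ))
          (fderivWithin ℝ w (halfSpace E) (x, τ) (0, 1)) (Ici τ) τ :=
        hd.comp_hasDerivWithinAt (f := fun τ : ℝ => (x, τ)) (f' := ((0 : E), (1 : ℝ))) τ
          (((hasDerivAt_const τ x).prodMk (hasDerivAt_id τ)).hasDerivWithinAt)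
          fun σ hσ => ⟨mem_univ _, hτ.1.trans hσ⟩
      rwa [hw.fderivWithin_time_eq_zero x h] at h2
  have := constant_of_has_deriv_right_zero hcont hder t ⟨ht, le_rfl⟩
  rw [this, hw.initial]

/-- Uniqueness for the wave equation, without growth assumptions at infinity. -/
theorem IsWaveSolution.eqOn {f : E → ℝ} {p q : E × ℝ → ℝ} (hp : IsWaveSolution f p)
    (hq : IsWaveSolution f q) : EqOn q p (halfSpace E) := fun _ hz =>
  sub_eq_zero.1 ((hp.sub hq).eq_zero hz)

theorem IsWaveSolution.isWellPosed {f : E → ℝ} {p : E × ℝ → ℝ} (hp : IsWaveSolution f p) :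
    IsWellPosed f := ⟨p, hp, fun _ hq => hp.eqOn hq⟩

theorem IsWaveSolution.waveOp_eq {f : E → ℝ} {p : E × ℝ → ℝ} (hp : IsWaveSolution f p)
    (S : Set E) (z : S × Ioi (0 : ℝ)) : waveOp S f z = p ((z.1 : E), (z.2 : ℝ)) := by
  have h : ∃ p, IsWaveSolution f p := ⟨p, hp⟩
  rw [waveOp, dif_pos h]
  exact hp.eqOn h.choose_spec ⟨mem_univ _, (mem_Ioi.1 z.2.2).le⟩

end EnergyMethod

/-! ### Powers of the operator `D = (2r)⁻¹ d/dr` -/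

section RadialDerivatives

theorem integrable_one_add_abs_rpow {ε : ℝ} (hε : 0 < ε) :
    Integrable fun t : ℝ => (1 + |t|) ^ (-(1 + ε)) := by
  have := integrable_one_add_norm (E := ℝ) (μ := volume) (r := 1 + ε) (by simp [hε])
  simpa using this

theorem radialD_iterate_succ (v : ℝ → ℝ) (i : ℕ) (r : ℝ) :
    radialD^[i + 1] v r = 1 / (2 * r) * deriv (radialD^[i] v) r := by
  rw [Function.iterate_succ_apply']
  rfl

/-- On `(0, ∞)`, `D^i v` is a combination of the functions `v^{(m)}(r) r^{m - 2i}`, `m ≤ i`. -/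
theorem exists_radialD_iterate_eq {v : ℝ → ℝ} {k : ℕ} (hv : ContDiff ℝ k v) {i : ℕ} (hi : i ≤ k) :
    ∃ c : ℕ → ℝ, ∀ r : ℝ, 0 < r → radialD^[i] v r =
      ∑ m ∈ Finset.range (i + 1), c m * (iteratedDeriv m v r * r ^ ((m : ℤ) - 2 * i)) := by
  induction i with
  | zero => exact ⟨fun _ => 1, fun r _ => by simp⟩
  | succ i ih =>
    obtain ⟨c, hc⟩ := ih (by omega)
    refine ⟨fun m => (if m = 0 then 0 else c (m - 1) / 2) +
      (if m < i + 1 then c m * ((m : ℤ) - 2 * i : ℤ) / 2 else 0), fun r hr => ?_⟩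
    have hder : HasDerivAt (fun r => ∑ m ∈ Finset.range (i + 1),
        c m * (iteratedDeriv m v r * r ^ ((m : ℤ) - 2 * i)))
        (∑ m ∈ Finset.range (i + 1), c m * (iteratedDeriv (m + 1) v r * r ^ ((m : ℤ) - 2 * i) +
          iteratedDeriv m v r * (((m : ℤ) - 2 * i : ℤ) * r ^ ((m : ℤ) - 2 * i - 1)))) r := by
      refine HasDerivAt.fun_sum fun m hm => ((HasDerivAt.mul ?_ ?_).const_mul _)
      · have hm' : m < k := by have := Finset.mem_range.1 hm; omega
        have := (hv.differentiable_iteratedDeriv m (by exact_mod_cast hm') r).hasDerivAt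
        rwa [← iteratedDeriv_succ] at this
      · exact hasDerivAt_zpow _ _ (.inl hr.ne')
    have hev : radialD^[i] v =ᶠ[𝓝 r] fun r => ∑ m ∈ Finset.range (i + 1),
        c m * (iteratedDeriv m v r * r ^ ((m : ℤ) - 2 * i)) := by
      filter_upwards [lt_mem_nhds hr] with s hs using hc s hs
    rw [radialD_iterate_succ, hev.deriv_eq, hder.deriv]
    simp only [add_mul, Finset.sum_add_distrib]
    have h1 : ∑ m ∈ Finset.range (i + 1 + 1), (if m = 0 then 0 else c (m - 1) / 2) *
        (iteratedDeriv m v r * r ^ ((m : ℤ) - 2 * ((i + 1 : ℕ) : ℤ))) =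
        ∑ m ∈ Finset.range (i + 1), c m / 2 *
          (iteratedDeriv (m + 1) v r * r ^ (((m + 1 : ℕ) : ℤ) - 2 * ((i + 1 : ℕ) : ℤ))) := by
      rw [Finset.sum_range_succ']
      simp
    have h2 : ∑ m ∈ Finset.range (i + 1 + 1), (if m < i + 1 then
        c m * ((m : ℤ) - 2 * i : ℤ) / 2 else 0) *
        (iteratedDeriv m v r * r ^ ((m : ℤ) - 2 * ((i + 1 : ℕ) : ℤ))) =
        ∑ m ∈ Finset.range (i + 1), (c m * ((m : ℤ) - 2 * i : ℤ) / 2) *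
          (iteratedDeriv m v r * r ^ ((m : ℤ) - 2 * ((i + 1 : ℕ) : ℤ))) := by
      rw [Finset.sum_range_succ]
      simp only [lt_irrefl, if_false, zero_mul, add_zero]
      exact Finset.sum_congr rfl fun m hm => by rw [if_pos (Finset.mem_range.1 hm)]
    rw [h1, h2, Finset.mul_sum, ← Finset.sum_add_distrib]
    refine Finset.sum_congr rfl fun m _ => ?_
    have e1 : r ^ ((m : ℤ) - 2 * i) = r * r ^ (((m + 1 : ℕ) : ℤ) - 2 * ((i + 1 : ℕ) : ℤ)) := by
      rw [← zpow_one_add₀ hr.ne']; congr 1; push_cast; ring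
    have e2 : r ^ ((m : ℤ) - 2 * i - 1) = r * r ^ ((m : ℤ) - 2 * ((i + 1 : ℕ) : ℤ)) := by
      rw [← zpow_one_add₀ hr.ne']; congr 1; push_cast; ring
    rw [e1, e2]
    field_simp

variable {v : ℝ → ℝ} {k : ℕ} (hv : ContDiff ℝ k v)
include hv

theorem continuousOn_radialD_iterate {i : ℕ} (hi : i ≤ k) :
    ContinuousOn (radialD^[i] v) (Ioi 0) := by
  obtain ⟨c, hc⟩ := exists_radialD_iterate_eq hv hi
  refine ContinuousOn.congr (continuousOn_finsetSum _ fun m hm => ?_) fun r hr => hc r hr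
  refine continuousOn_const.mul (ContinuousOn.mul ?_ ?_)
  · exact (hv.continuous_iteratedDeriv m (by
      have := Finset.mem_range.1 hm; exact_mod_cast (by omega : m ≤ k))).continuousOn
  · exact fun r hr => (continuousAt_zpow₀ _ _ (.inl (ne_of_gt hr))).continuousWithinAt

theorem hasDerivAt_radialD_iterate {i : ℕ} (hi : i < k) {r : ℝ} (hr : 0 < r) :
    HasDerivAt (radialD^[i] v) (2 * r * radialD^[i + 1] v r) r := by
  obtain ⟨c, hc⟩ := exists_radialD_iterate_eq hv hi.le
  have hev : radialD^[i] v =ᶠ[𝓝 r] fun r => ∑ m ∈ Finset.range (i + 1),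
      c m * (iteratedDeriv m v r * r ^ ((m : ℤ) - 2 * i)) := by
    filter_upwards [lt_mem_nhds hr] with s hs using hc s hs
  have hd : DifferentiableAt ℝ (radialD^[i] v) r := by
    refine (hev.differentiableAt_iff).2 (DifferentiableAt.fun_sum fun m hm => ?_)
    have hm' : m < k := by have := Finset.mem_range.1 hm; omega
    exact ((hv.differentiable_iteratedDeriv m (by exact_mod_cast hm') r).mul
      (differentiableAt_zpow.2 (.inl hr.ne'))).const_mul _
  have := hd.hasDerivAt
  have h2 : 2 * r * radialD^[i + 1] v r = deriv (radialD^[i] v) r := by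
    rw [radialD_iterate_succ]; field_simp
  rwa [h2]

/-- The decay hypothesis on `v` is inherited by `r^{2i} D^i v(r)`, uniformly down to `r = 0`. -/
theorem exists_radialD_iterate_bound {C ε : ℝ}
    (hdec : ∀ i : ℕ, i ≤ k → ∀ t : ℝ, |iteratedDeriv i v t| ≤ C * (1 + |t|) ^ (-((i : ℝ) + 1 + ε)))
    {i : ℕ} (hi : i ≤ k) :
    ∃ M, 0 ≤ M ∧ ∀ r : ℝ, 0 < r → r ^ (2 * i) * |radialD^[i] v r| ≤ M * (1 + r) ^ (-(1 + ε)) := by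
  obtain ⟨c, hc⟩ := exists_radialD_iterate_eq hv hi
  have hC : 0 ≤ C := by
    have := (abs_nonneg _).trans (hdec 0 (Nat.zero_le _) 0)
    simpa using this
  refine ⟨∑ m ∈ Finset.range (i + 1), |c m| * C, by positivity, fun r hr => ?_⟩
  rw [hc r hr, Finset.sum_mul]
  refine (mul_le_mul_of_nonneg_left (Finset.abs_sum_le_sum_abs _ _) (by positivity)).trans ?_
  rw [Finset.mul_sum]
  refine Finset.sum_le_sum fun m hm => ?_
  have hm' : m ≤ k := by have := Finset.mem_range.1 hm; omega
  have h1 := hdec m hm' r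
  rw [abs_of_pos hr] at h1
  rw [abs_mul, abs_mul, abs_of_pos (zpow_pos hr _)]
  have h2 : r ^ (2 * i) * r ^ ((m : ℤ) - 2 * i) = r ^ m := by
    rw [← zpow_natCast, ← zpow_natCast, ← zpow_add₀ hr.ne']; congr 1; push_cast; ring
  calc r ^ (2 * i) * (|c m| * (|iteratedDeriv m v r| * r ^ ((m : ℤ) - 2 * i)))
      = |c m| * (|iteratedDeriv m v r| * r ^ m) := by rw [← h2]; ring
    _ ≤ |c m| * ((C * (1 + r) ^ (-((m : ℝ) + 1 + ε))) * (1 + r) ^ m) := by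
      gcongr; linarith
    _ = |c m| * C * (1 + r) ^ (-(1 + ε)) := by
      rw [mul_assoc C, ← Real.rpow_natCast (1 + r) m, ← Real.rpow_add (by linarith)]
      rw [mul_assoc]; congr 4; ring

end RadialDerivatives

/-! ### Integrating out the powers of `D` -/

section RadialIntegral

variable {v : ℝ → ℝ} {k : ℕ} (hv : ContDiff ℝ k v) {C ε : ℝ} (hε : 0 < ε)
  (hdec : ∀ i : ℕ, i ≤ k → ∀ t : ℝ, |iteratedDeriv i v t| ≤ C * (1 + |t|) ^ (-((i : ℝ) + 1 + ε)))
include hv hε hdec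

omit hε in
theorem exists_shifted_bound (hε : 0 < ε) {s : ℝ} (hs : s ≠ 0) {i : ℕ} (hi : i ≤ k) :
    ∃ M, 0 ≤ M ∧ ∀ r : ℝ, 0 ≤ r →
      r ^ (2 * i) * |radialD^[i] v √(s ^ 2 + r ^ 2)| ≤ M * (1 + r) ^ (-(1 + ε)) := by
  obtain ⟨M, hM0, hM⟩ := exists_radialD_iterate_bound hv hdec hi
  refine ⟨M, hM0, fun r hr => ?_⟩
  have hs2 : 0 < s ^ 2 := by positivity
  have hρ : 0 < √(s ^ 2 + r ^ 2) := Real.sqrt_pos.2 (by positivity)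
  have hrρ : r ≤ √(s ^ 2 + r ^ 2) := Real.le_sqrt_of_sq_le (by linarith)
  calc r ^ (2 * i) * |radialD^[i] v √(s ^ 2 + r ^ 2)|
      ≤ √(s ^ 2 + r ^ 2) ^ (2 * i) * |radialD^[i] v √(s ^ 2 + r ^ 2)| := by gcongr
    _ ≤ M * (1 + √(s ^ 2 + r ^ 2)) ^ (-(1 + ε)) := hM _ hρ
    _ ≤ M * (1 + r) ^ (-(1 + ε)) := by
      refine mul_le_mul_of_nonneg_left ?_ hM0
      exact Real.rpow_le_rpow_of_nonpos (by linarith) (by linarith) (by linarith)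

theorem integrableOn_shifted {s : ℝ} (hs : s ≠ 0) {n : ℕ} (hn : n + 1 ≤ k) :
    IntegrableOn (fun r : ℝ => r ^ (2 * n + 1) * radialD^[n + 1] v √(s ^ 2 + r ^ 2)) (Ioi 0) := by
  obtain ⟨M, hM0, hM⟩ := exists_radialD_iterate_bound hv hdec hn
  have hs2 : 0 < s ^ 2 := by positivity
  have hcont : ContinuousOn (fun r : ℝ => r ^ (2 * n + 1) * radialD^[n + 1] v √(s ^ 2 + r ^ 2))
      (Ioi 0) := by
    refine (by fun_prop : Continuous fun r : ℝ => r ^ (2 * n + 1)).continuousOn.mul ?_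
    exact (continuousOn_radialD_iterate hv hn).comp (by fun_prop) fun r _ =>
      Real.sqrt_pos.2 (by positivity)
  refine Integrable.mono' (((integrable_one_add_abs_rpow hε).const_mul (M / |s|)).integrableOn)
    (hcont.aestronglyMeasurable measurableSet_Ioi) ?_
  refine (ae_restrict_mem measurableSet_Ioi).mono fun r hr => ?_
  have hr : 0 < r := hr
  set ρ := √(s ^ 2 + r ^ 2) with hρd
  have hρ : 0 < ρ := Real.sqrt_pos.2 (by positivity)
  have hrρ : r ≤ ρ := Real.le_sqrt_of_sq_le (by linarith)
  have hsρ : |s| ≤ ρ := Real.le_sqrt_of_sq_le (by rw [sq_abs]; nlinarith)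
  have hsp : 0 < |s| := abs_pos.2 hs
  rw [norm_mul, Real.norm_of_nonneg (by positivity), Real.norm_eq_abs, abs_of_pos hr,
    div_mul_eq_mul_div, le_div_iff₀ hsp]
  calc r ^ (2 * n + 1) * |radialD^[n + 1] v ρ| * |s|
      ≤ ρ ^ (2 * n + 1) * |radialD^[n + 1] v ρ| * ρ := by gcongr
    _ = ρ ^ (2 * (n + 1)) * |radialD^[n + 1] v ρ| := by ring
    _ ≤ M * (1 + ρ) ^ (-(1 + ε)) := hM _ hρ
    _ ≤ M * (1 + r) ^ (-(1 + ε)) := by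
      refine mul_le_mul_of_nonneg_left ?_ hM0
      exact Real.rpow_le_rpow_of_nonpos (by linarith) (by linarith) (by linarith)

/-- Repeated integration by parts: `D` is `d/dq` in the variable `q = r²`, so integrating
`D^{n+1} v` against `q^n` undoes all the derivatives. -/
theorem integral_shifted {s : ℝ} (hs : s ≠ 0) {n : ℕ} (hn : n + 1 ≤ k) :
    ∫ r in Ioi (0 : ℝ), r ^ (2 * n + 1) * radialD^[n + 1] v √(s ^ 2 + r ^ 2) =
      (-1) ^ (n + 1) * n.factorial / 2 * v |s| := by
  have hs2 : 0 < s ^ 2 := by positivity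
  have hder : ∀ m : ℕ, m + 1 ≤ k → ∀ r : ℝ, HasDerivAt
      (fun r : ℝ => r ^ (2 * m) / 2 * radialD^[m] v √(s ^ 2 + r ^ 2))
      (m * (r ^ (2 * m - 1) * radialD^[m] v √(s ^ 2 + r ^ 2)) +
        r ^ (2 * m + 1) * radialD^[m + 1] v √(s ^ 2 + r ^ 2)) r := by
    intro m hm r
    have hρ : 0 < √(s ^ 2 + r ^ 2) := Real.sqrt_pos.2 (by positivity)
    have h1 : HasDerivAt (fun r : ℝ => √(s ^ 2 + r ^ 2)) (r / √(s ^ 2 + r ^ 2)) r := by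
      have := (((hasDerivAt_pow 2 r).const_add (s ^ 2))).sqrt (by positivity)
      convert this using 1
      field_simp
      simp [mul_comm]
    have h2 := (hasDerivAt_radialD_iterate hv (i := m) (by omega) hρ).comp r h1
    have h3 := ((hasDerivAt_pow (2 * m) r).div_const 2).mul h2
    refine h3.congr_deriv ?_
    simp only [Function.comp]
    push_cast
    field_simp
    ring
  have htend : ∀ m : ℕ, m ≤ k → Tendsto
      (fun r : ℝ => r ^ (2 * m) / 2 * radialD^[m] v √(s ^ 2 + r ^ 2)) atTop (𝓝 0) := by
    intro m hm
    obtain ⟨M, hM0, hM⟩ := exists_shifted_bound hv hdec hε hs hm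
    have h0 : Tendsto (fun r : ℝ => M * (1 + r) ^ (-(1 + ε))) atTop (𝓝 0) := by
      have h1 : Tendsto (fun r : ℝ => (1 + r) ^ (-(1 + ε))) atTop (𝓝 0) :=
        (tendsto_rpow_neg_atTop (by linarith)).comp (tendsto_atTop_add_const_left _ _ tendsto_id)
      simpa using h1.const_mul M
    refine squeeze_zero_norm' ?_ h0
    filter_upwards [eventually_ge_atTop (0 : ℝ)] with r hr
    rw [norm_mul, Real.norm_eq_abs, Real.norm_eq_abs, abs_of_nonneg (by positivity)]
    refine le_trans ?_ (hM r hr)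
    have : 0 ≤ r ^ (2 * m) * |radialD^[m] v √(s ^ 2 + r ^ 2)| := by positivity
    linarith
  induction n with
  | zero =>
    have hF := integral_Ioi_of_hasDerivAt_of_tendsto' (a := 0) (m := 0) (fun r _ => hder 0 hn r)
      (by simpa using integrableOn_shifted hv hε hdec hs hn) (htend 0 (by omega))
    simp only [Nat.cast_zero, zero_mul, zero_add, mul_zero, pow_zero, Function.iterate_zero,
      id_eq] at hF
    simp only [mul_zero, zero_add]
    rw [hF]
    have : √(s ^ 2 + 0 ^ 2) = |s| := by simp [Real.sqrt_sq_eq_abs]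
    rw [this]
    simp
    ring
  | succ n ih =>
    have hi1 := integrableOn_shifted hv hε hdec hs (n := n) (by omega)
    have hi2 := integrableOn_shifted hv hε hdec hs hn
    have hi1' : IntegrableOn (fun r : ℝ => ((n + 1 : ℕ) : ℝ) * (r ^ (2 * (n + 1) - 1) *
        radialD^[n + 1] v √(s ^ 2 + r ^ 2))) (Ioi 0) := hi1.const_mul _
    have hF := integral_Ioi_of_hasDerivAt_of_tendsto' (a := 0) (m := 0)
      (fun r _ => hder (n + 1) hn r) (hi1'.add hi2) (htend (n + 1) (by omega))
    rw [integral_add hi1' hi2, integral_const_mul] at hF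
    have h2 : 2 * (n + 1) - 1 = 2 * n + 1 := by omega
    rw [h2, ih (by omega)] at hF
    simp only [ne_eq, Nat.mul_eq_zero, OfNat.ofNat_ne_zero, Nat.add_eq_zero_iff, one_ne_zero,
      and_false, or_self, not_false_eq_true, zero_pow, zero_div, zero_mul, sub_zero] at hF
    rw [Nat.factorial_succ]
    push_cast at hF ⊢
    linear_combination hF

end RadialIntegral

/-! ### Splitting off one coordinate -/

section Coordinates

/-- The splitting `ℝ × ℝⁿ ≃ ℝⁿ⁺¹`, `(s, y) ↦ (s, y₁, …, yₙ)`. -/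
noncomputable def consEquiv (n : ℕ) :
    ℝ × EuclideanSpace ℝ (Fin n) ≃ᵐ EuclideanSpace ℝ (Fin (n + 1)) :=
  ((MeasurableEquiv.prodCongr (MeasurableEquiv.refl ℝ)
    (MeasurableEquiv.toLp 2 (Fin n → ℝ)).symm).trans
    (MeasurableEquiv.piFinSuccAbove (fun _ : Fin (n + 1) => ℝ) 0).symm).trans
    (MeasurableEquiv.toLp 2 (Fin (n + 1) → ℝ))

theorem measurePreserving_consEquiv (n : ℕ) : MeasurePreserving (consEquiv n) := by
  refine MeasurePreserving.trans (MeasurePreserving.trans ?_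
    (volume_preserving_piFinSuccAbove (fun _ : Fin (n + 1) => ℝ) 0).symm)
    (PiLp.volume_preserving_toLp _)
  exact (MeasurePreserving.id _).prod (PiLp.volume_preserving_ofLp _)

theorem consEquiv_zero {n : ℕ} (z : ℝ × EuclideanSpace ℝ (Fin n)) : consEquiv n z 0 = z.1 := rfl

theorem consEquiv_succ {n : ℕ} (z : ℝ × EuclideanSpace ℝ (Fin n)) (i : Fin n) :
    consEquiv n z i.succ = z.2 i := rfl

theorem inner_consEquiv {n : ℕ} (z w : ℝ × EuclideanSpace ℝ (Fin n)) :
    inner ℝ (consEquiv n z) (consEquiv n w) = z.1 * w.1 + inner ℝ z.2 w.2 := by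
  simp only [PiLp.inner_apply, Fin.sum_univ_succ, consEquiv_zero, consEquiv_succ]
  simp [mul_comm]

theorem norm_consEquiv {n : ℕ} (z : ℝ × EuclideanSpace ℝ (Fin n)) :
    ‖consEquiv n z‖ = √(z.1 ^ 2 + ‖z.2‖ ^ 2) := by
  rw [← Real.sqrt_sq (norm_nonneg (consEquiv n z)), ← real_inner_self_eq_norm_sq, inner_consEquiv,
    real_inner_self_eq_norm_sq, pow_two z.1]

end Coordinates

/-! ### The Fourier slice identity -/

section FourierRadial

/-- The Fourier transform of a radial function is radial. -/
theorem fourierD_comp_norm {E : Type*} [NormedAddCommGroup E] [InnerProductSpace ℝ E]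
    [FiniteDimensional ℝ E] [MeasurableSpace E] [BorelSpace E] (g : ℝ → ℝ) {ξ η : E}
    (h : ‖ξ‖ = ‖η‖) : fourierD (fun x : E => g ‖x‖) ξ = fourierD (fun x : E => g ‖x‖) η := by
  set A : E ≃ₗᵢ[ℝ] E := (ℝ ∙ (ξ - η))ᗮ.reflection
  have hA : A ξ = η := Submodule.reflection_sub h
  rw [← hA]
  symm
  rw [fourierD, fourierD, ← (A.measurePreserving).integral_comp
    A.toHomeomorph.measurableEmbedding]
  simp only [A.norm_map, A.inner_map_map]

variable {v : ℝ → ℝ} {k : ℕ} (hv : ContDiff ℝ k v) {C ε : ℝ} (hε : 0 < ε)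
  (hdec : ∀ i : ℕ, i ≤ k → ∀ t : ℝ, |iteratedDeriv i v t| ≤ C * (1 + |t|) ^ (-((i : ℝ) + 1 + ε)))
include hv hε hdec

theorem integrable_radialD_norm : Integrable
    fun x : EuclideanSpace ℝ (Fin (2 * k + 1)) => radialD^[k] v ‖x‖ := by
  have hcont := continuousOn_radialD_iterate hv le_rfl
  obtain ⟨M, hM0, hM⟩ := exists_radialD_iterate_bound hv hdec le_rfl
  refine (integrable_fun_norm_addHaar volume (f := radialD^[k] v)).2 ?_
  rw [finrank_euclideanSpace_fin, Nat.add_sub_cancel]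
  refine Integrable.mono' (((integrable_one_add_abs_rpow hε).const_mul M).integrableOn)
    ((((continuous_pow (2 * k)).continuousOn).smul hcont).aestronglyMeasurable
      measurableSet_Ioi) ?_
  refine (ae_restrict_mem measurableSet_Ioi).mono fun r hr => ?_
  have hr : 0 < r := hr
  rw [norm_smul, Real.norm_of_nonneg (by positivity), Real.norm_eq_abs, abs_of_pos hr]
  exact hM r hr

/-- The integral of the radial function `D^k v` over a `2k`-dimensional slice at distance `|s|` from
the origin. For `k = 0` the slice is a point. -/
theorem integral_slice_radialD {s : ℝ} (hs : s ≠ 0) :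
    ∫ y : EuclideanSpace ℝ (Fin (2 * k)), radialD^[k] v √(s ^ 2 + ‖y‖ ^ 2) =
      (-Real.pi) ^ k * v |s| := by
  rcases k with _ | n
  · have : IsEmpty (Fin (2 * 0)) := inferInstanceAs (IsEmpty (Fin 0))
    have hvol : (volume : Measure (EuclideanSpace ℝ (Fin (2 * 0)))) = Measure.dirac 0 :=
      volume_euclideanSpace_eq_dirac _
    rw [hvol, integral_dirac]
    simp [Real.sqrt_sq_eq_abs]
  · have : Nontrivial (EuclideanSpace ℝ (Fin (2 * (n + 1)))) := by
      have : Nonempty (Fin (2 * (n + 1))) := ⟨⟨0, by omega⟩⟩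
      infer_instance
    have h1 := integral_fun_norm_addHaar (volume : Measure (EuclideanSpace ℝ (Fin (2 * (n + 1)))))
      (fun r => radialD^[n + 1] v √(s ^ 2 + r ^ 2))
    rw [h1, finrank_euclideanSpace_fin]
    have h2 : 2 * (n + 1) - 1 = 2 * n + 1 := by omega
    simp only [smul_eq_mul, h2]
    rw [integral_shifted hv hε hdec hs le_rfl, Measure.real,
      InnerProductSpace.volume_ball_of_dim_even (k := n + 1) (by simp)]
    have hfac : ((n + 1).factorial : ℝ) ≠ 0 := by positivity
    rw [ENNReal.toReal_mul, ENNReal.toReal_pow, ENNReal.toReal_ofReal (by simp),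
      ENNReal.toReal_ofReal (by positivity), Nat.factorial_succ, neg_pow Real.pi]
    rw [nsmul_eq_mul]
    push_cast
    field_simp
    rw [one_pow, one_mul]

/-- The Fourier slice identity: up to the constant `(-π)^k`, the radial function `D^k v` on
`ℝ^{2k+1}` has Radon transform `v`, so its Fourier transform is that of `v`. -/
theorem fourierD_radialD_norm (heven : v.Even) (ξ : EuclideanSpace ℝ (Fin (2 * k + 1))) :
    fourierD (fun x : EuclideanSpace ℝ (Fin (2 * k + 1)) => radialD^[k] v ‖x‖) ξ =
      ((-Real.pi) ^ k : ℝ) * fourierD v ‖ξ‖ := by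
  have hnorm : ‖ξ‖ = ‖consEquiv (2 * k) (‖ξ‖, 0)‖ := by
    rw [norm_consEquiv]; simp
  have hU := integrable_radialD_norm hv hε hdec
  rw [fourierD_comp_norm _ hnorm]
  have hint : Integrable (fun x : EuclideanSpace ℝ (Fin (2 * k + 1)) =>
      ((radialD^[k] v ‖x‖ : ℝ) : ℂ) *
        Complex.exp (-(Complex.I * (inner ℝ x (consEquiv (2 * k) (‖ξ‖, 0)) : ℝ)))) := by
    refine hU.ofReal.mul_bdd (c := 1) (Continuous.aestronglyMeasurable (by fun_prop))
      (.of_forall fun x => ?_)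
    rw [Complex.norm_exp]; simp
  have hint2 := ((measurePreserving_consEquiv (2 * k)).integrable_comp_emb
    (consEquiv (2 * k)).measurableEmbedding).2 hint
  rw [fourierD, ← (measurePreserving_consEquiv (2 * k)).integral_comp
    (consEquiv (2 * k)).measurableEmbedding]
  rw [Measure.volume_eq_prod, Function.comp_def] at hint2
  rw [Measure.volume_eq_prod]
  rw [integral_prod _ hint2, fourierD, ← integral_const_mul]
  refine integral_congr_ae ?_
  have hne : ∀ᵐ s : ℝ, s ≠ 0 := by simp [ae_iff]
  filter_upwards [hne] with s hs
  simp only [inner_consEquiv, norm_consEquiv, inner_zero_right, add_zero]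
  rw [integral_mul_const, integral_complex_ofReal, integral_slice_radialD hv hε hdec hs]
  have hvs : v |s| = v s := by
    rcases abs_choice s with h | h
    · rw [h]
    · rw [h, heven]
  rw [hvs]
  push_cast
  rw [mul_assoc]
  congr 4
  simp [mul_comm]

end FourierRadial

/-! ### The Fourier transform of the filters -/

section RadonSharp

variable {v : ℝ → ℝ} {k : ℕ} (hv : ContDiff ℝ k v) {C ε : ℝ} (hε : 0 < ε)
  (hdec : ∀ i : ℕ, i ≤ k → ∀ t : ℝ, |iteratedDeriv i v t| ≤ C * (1 + |t|) ^ (-((i : ℝ) + 1 + ε)))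

theorem radonSharp_const_mul (k : ℕ) :
    (((-1 : ℝ) ^ k / √(Real.pi ^ (2 * k)) : ℝ)) * (-Real.pi) ^ k = 1 := by
  rw [pow_mul', Real.sqrt_sq (by positivity), neg_pow Real.pi]
  have : Real.pi ^ k ≠ 0 := by positivity
  field_simp
  rw [← pow_mul, mul_comm, pow_mul]; simp

theorem radonSharp_odd (v : ℝ → ℝ) (k : ℕ) (x : EuclideanSpace ℝ (Fin (2 * k + 1))) :
    radonSharp (2 * k + 1) v x = (-1) ^ k / √(Real.pi ^ (2 * k)) * radialD^[k] v ‖x‖ := by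
  rw [radonSharp, if_pos ⟨k, rfl⟩]
  have : (2 * k + 1 - 1) / 2 = k := by omega
  rw [this, Nat.add_sub_cancel]

/-- In even dimension the Abel integral in the definition of `radonSharp` is, after the
substitution `t² = ‖x‖² + y²`, the integral over one additional coordinate `y`. -/
theorem radonSharp_even (v : ℝ → ℝ) (k : ℕ) {x : EuclideanSpace ℝ (Fin (2 * k))} (hx : x ≠ 0) :
    radonSharp (2 * k) v x = (-1) ^ k / √(Real.pi ^ (2 * k)) *
      ∫ y : ℝ, radialD^[k] v √(y ^ 2 + ‖x‖ ^ 2) := by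
  have hodd : ¬ Odd (2 * k) := by simp
  rw [radonSharp, if_neg hodd]
  have hk : 2 * k / 2 = k := by omega
  rw [hk]
  have hx0 : 0 < ‖x‖ := norm_pos_iff.2 hx
  set a := ‖x‖ with ha
  have h1 : ∫ y : ℝ, radialD^[k] v √(y ^ 2 + a ^ 2) =
      2 * ∫ y in Ioi (0 : ℝ), radialD^[k] v √(y ^ 2 + a ^ 2) := by
    rw [← integral_comp_abs (f := fun y => radialD^[k] v √(y ^ 2 + a ^ 2))]
    simp
  have h2 : ∀ y ∈ Ioi (0 : ℝ), HasDerivWithinAt (fun y : ℝ => √(y ^ 2 + a ^ 2))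
      (y / √(y ^ 2 + a ^ 2)) (Ioi 0) y := by
    intro y hy
    have := (((hasDerivAt_pow 2 y).add_const (a ^ 2))).sqrt (by positivity)
    refine (this.congr_deriv ?_).hasDerivWithinAt
    field_simp
    simp [mul_comm]
  have hmono : StrictMonoOn (fun y : ℝ => √(y ^ 2 + a ^ 2)) (Ioi 0) := by
    intro y hy z hz hyz
    have hy : 0 < y := hy
    exact Real.sqrt_lt_sqrt (by positivity) (by gcongr)
  have h3 : (fun y : ℝ => √(y ^ 2 + a ^ 2)) '' Ioi 0 = Ioi a := by
    ext t
    constructor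
    · rintro ⟨y, hy, rfl⟩
      have hy : 0 < y := hy
      exact Real.lt_sqrt_of_sq_lt (by nlinarith)
    · intro ht
      have ht : a < t := ht
      have h : 0 < t ^ 2 - a ^ 2 := by nlinarith
      refine ⟨√(t ^ 2 - a ^ 2), Real.sqrt_pos.2 h, ?_⟩
      simp only
      rw [Real.sq_sqrt h.le, sub_add_cancel, Real.sqrt_sq (by linarith)]
  rw [h1, ← h3, integral_image_eq_integral_abs_deriv_smul measurableSet_Ioi h2 hmono.injOn]
  have h4 : ∫ y in Ioi (0 : ℝ), |y / √(y ^ 2 + a ^ 2)| • (radialD^[k] v √(y ^ 2 + a ^ 2) /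
      √(√(y ^ 2 + a ^ 2) ^ 2 - a ^ 2) * √(y ^ 2 + a ^ 2)) =
      ∫ y in Ioi (0 : ℝ), radialD^[k] v √(y ^ 2 + a ^ 2) := by
    refine setIntegral_congr_fun measurableSet_Ioi fun y hy => ?_
    have hy : 0 < y := hy
    have hρ : 0 < √(y ^ 2 + a ^ 2) := Real.sqrt_pos.2 (by positivity)
    simp only [smul_eq_mul]
    rw [Real.sq_sqrt (by positivity), add_sub_cancel_right, Real.sqrt_sq hy.le,
      abs_of_pos (by positivity)]
    field_simp
  rw [h4]
  ring

include hv hε hdec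

theorem radonSharp_odd_spec (heven : v.Even) :
    Integrable (radonSharp (2 * k + 1) v) ∧
      ∀ ξ, fourierD (radonSharp (2 * k + 1) v) ξ = fourierD v ‖ξ‖ := by
  have hfun : radonSharp (2 * k + 1) v = fun x => (-1) ^ k / √(Real.pi ^ (2 * k)) *
      radialD^[k] v ‖x‖ := funext (radonSharp_odd v k)
  rw [hfun]
  refine ⟨(integrable_radialD_norm hv hε hdec).const_mul _, fun ξ => ?_⟩
  have h1 := fourierD_radialD_norm hv hε hdec heven ξ
  have h2 := congrArg (fun r : ℝ => (r : ℂ)) (radonSharp_const_mul k)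
  rw [fourierD] at h1 ⊢
  push_cast at h1 h2 ⊢
  simp only [mul_assoc]
  rw [integral_const_mul, h1, ← mul_assoc, h2, one_mul]

/-- In dimension `2k` the filter is the integral over one coordinate of the filter in dimension
`2k + 1`, so its Fourier transform is a restriction of the Fourier transform of the latter. -/
theorem radonSharp_even_spec (hk : 1 ≤ k) (heven : v.Even) :
    Integrable (radonSharp (2 * k) v) ∧
      ∀ ξ, fourierD (radonSharp (2 * k) v) ξ = fourierD v ‖ξ‖ := by
  have hU := integrable_radialD_norm hv hε hdec
  have hU2 := ((measurePreserving_consEquiv (2 * k)).integrable_comp_emb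
    (consEquiv (2 * k)).measurableEmbedding).2 hU
  rw [Measure.volume_eq_prod] at hU2
  have : Nontrivial (EuclideanSpace ℝ (Fin (2 * k))) := by
    have : Nonempty (Fin (2 * k)) := ⟨⟨0, by omega⟩⟩
    infer_instance
  have hne : ∀ᵐ x : EuclideanSpace ℝ (Fin (2 * k)), x ≠ 0 := by simp [ae_iff]
  set c : ℝ := (-1) ^ k / √(Real.pi ^ (2 * k)) with hc
  have hae : radonSharp (2 * k) v =ᵐ[volume] fun x =>
      c * ∫ y : ℝ, radialD^[k] v ‖consEquiv (2 * k) (y, x)‖ := by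
    filter_upwards [hne] with x hx
    simp only [norm_consEquiv]
    exact radonSharp_even v k hx
  have hI : Integrable fun x : EuclideanSpace ℝ (Fin (2 * k)) =>
      ∫ y : ℝ, radialD^[k] v ‖consEquiv (2 * k) (y, x)‖ := hU2.integral_prod_right
  refine ⟨(hI.const_mul c).congr hae.symm, fun ξ => ?_⟩
  have h1 := fourierD_radialD_norm hv hε hdec heven (consEquiv (2 * k) (0, ξ))
  have hnorm : ‖consEquiv (2 * k) (0, ξ)‖ = ‖ξ‖ := by rw [norm_consEquiv]; simp
  rw [hnorm] at h1
  have h2 : (c : ℂ) * (((-Real.pi) ^ k : ℝ) : ℂ) = 1 := by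
    rw [← Complex.ofReal_mul, radonSharp_const_mul, Complex.ofReal_one]
  have hint : Integrable (fun x : EuclideanSpace ℝ (Fin (2 * k + 1)) =>
      ((radialD^[k] v ‖x‖ : ℝ) : ℂ) *
        Complex.exp (-(Complex.I * (inner ℝ x (consEquiv (2 * k) (0, ξ)) : ℝ)))) := by
    refine hU.ofReal.mul_bdd (c := 1) (Continuous.aestronglyMeasurable (by fun_prop))
      (.of_forall fun x => ?_)
    rw [Complex.norm_exp]; simp
  have hint2 := ((measurePreserving_consEquiv (2 * k)).integrable_comp_emb
    (consEquiv (2 * k)).measurableEmbedding).2 hint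
  rw [fourierD, ← (measurePreserving_consEquiv (2 * k)).integral_comp
    (consEquiv (2 * k)).measurableEmbedding] at h1
  rw [Measure.volume_eq_prod, Function.comp_def] at hint2
  rw [Measure.volume_eq_prod] at h1
  rw [integral_prod_symm _ hint2] at h1
  have h3 : fourierD (radonSharp (2 * k) v) ξ = ∫ x, (c : ℂ) *
      ∫ y : ℝ, ((radialD^[k] v ‖consEquiv (2 * k) (y, x)‖ : ℝ) : ℂ) *
        Complex.exp (-(Complex.I * (inner ℝ (consEquiv (2 * k) (y, x))
          (consEquiv (2 * k) (0, ξ)) : ℝ))) := by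
    rw [fourierD]
    refine integral_congr_ae ?_
    filter_upwards [hae] with x hx
    simp only [inner_consEquiv, mul_zero, zero_add]
    rw [hx, integral_mul_const, integral_complex_ofReal]
    push_cast
    ring
  rw [h3, integral_const_mul, h1, ← mul_assoc, h2, one_mul]

end RadonSharp

/-- The filter `R^♯ v` is integrable and its Fourier transform is the radial extension of that of
`v`. -/
theorem radonSharp_spec {d : ℕ} (hd : 1 ≤ d) {v : ℝ → ℝ} (heven : v.Even)
    (hv : ContDiff ℝ ((d / 2 : ℕ) : WithTop ℕ∞) v) (hdec : HasSufficientDecay d v) :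
    Integrable (radonSharp d v) ∧ ∀ ξ, fourierD (radonSharp d v) ξ = fourierD v ‖ξ‖ := by
  obtain ⟨C, ε, hε, hdec⟩ := hdec
  obtain ⟨k, rfl | rfl⟩ := Nat.even_or_odd' d
  · have hk : 2 * k / 2 = k := by omega
    rw [hk] at hv hdec
    exact radonSharp_even_spec hv hε hdec (by omega) heven
  · have hk : (2 * k + 1) / 2 = k := by omega
    rw [hk] at hv hdec
    exact radonSharp_odd_spec hv hε hdec heven

/-! ### Pointwise consequences of the upper frame bound -/

section FrameBound

theorem eLpNorm_two_sq {α F : Type*} [MeasurableSpace α] [NormedAddCommGroup F] (f : α → F)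
    (μ : Measure α) : eLpNorm f 2 μ ^ 2 = ∫⁻ x, ‖f x‖ₑ ^ 2 ∂μ := by
  have := eLpNorm_nnreal_pow_eq_lintegral (f := f) (μ := μ) (p := 2) two_ne_zero
  simpa using this

theorem memLp_truncation {a : ℝ → ℝ} (ha : Continuous a) (ha1 : ∀ t, |a t| ≤ 1) (N : ℕ) :
    MemLp ((Icc (-(2 * N : ℝ)) (2 * N)).indicator a) 2 volume ∧
      eLpNorm ((Icc (-(2 * N : ℝ)) (2 * N)).indicator a) 2 volume ^ 2 ≤ 4 * N := by
  have h : eLpNorm ((Icc (-(2 * N : ℝ)) (2 * N)).indicator a) 2 volume ^ 2 ≤ 4 * N := by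
    rw [eLpNorm_two_sq]
    calc ∫⁻ x, ‖(Icc (-(2 * N : ℝ)) (2 * N)).indicator a x‖ₑ ^ 2
        ≤ ∫⁻ x, (Icc (-(2 * N : ℝ)) (2 * N)).indicator 1 x := by
          refine lintegral_mono fun x => ?_
          by_cases hx : x ∈ Icc (-(2 * N : ℝ)) (2 * N)
          · simp only [indicator_of_mem hx, Pi.one_apply]
            refine pow_le_one₀ (by simp) ?_
            rw [← ofReal_norm, ENNReal.ofReal_le_one]
            exact ha1 x
          · simp only [indicator_of_notMem hx]
            simp
      _ = 4 * N := by
          rw [lintegral_indicator_one measurableSet_Icc, Real.volume_Icc]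
          have : (2 * N - -(2 * N) : ℝ) = ((4 * N : ℕ) : ℝ) := by push_cast; ring
          rw [this, ENNReal.ofReal_natCast]
          push_cast; rfl
  refine ⟨⟨(ha.aestronglyMeasurable.indicator measurableSet_Icc), ?_⟩, h⟩
  have h4 : (4 * N : ℝ≥0∞) < ⊤ := ENNReal.mul_lt_top (by simp) (by simp)
  exact (ENNReal.pow_lt_top_iff.1 (h.trans_lt h4)).resolve_right two_ne_zero

/-- Convolving the wave `e^{iηt}`, truncated to `|t| ≤ 2N`, with `v` reproduces `v̂(η) e^{iηt}` on
`|t| ≤ N`, up to the tail of `v`. -/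
theorem norm_fourierD_sub_tail_le {v : ℝ → ℝ} (hi : Integrable v) (η : ℝ) (N : ℕ) {t : ℝ}
    (ht : t ∈ Icc (-(N : ℝ)) N) :
    ‖fourierD v η‖ - ∫ s in (Icc (-(N : ℝ)) N)ᶜ, |v s| ≤
      ‖((conv ((Icc (-(2 * N : ℝ)) (2 * N)).indicator fun s => Real.cos (η * s)) v t : ℝ) : ℂ) +
        Complex.I *
        (conv ((Icc (-(2 * N : ℝ)) (2 * N)).indicator fun s => Real.sin (η * s)) v t : ℝ)‖ := by
  set J := Icc (-(2 * N : ℝ)) (2 * N) with hJ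
  have hbd : ∀ a : ℝ → ℝ, Continuous a → (∀ t, |a t| ≤ 1) →
      Integrable fun s => J.indicator a (t - s) * v s := by
    intro a ha ha1
    have hm : Measurable (J.indicator a) := ha.measurable.indicator measurableSet_Icc
    refine hi.bdd_mul (c := 1)
      (hm.comp (measurable_const.sub measurable_id)).aestronglyMeasurable (.of_forall fun s => ?_)
    by_cases hx : t - s ∈ J
    · rw [indicator_of_mem hx]; exact ha1 _
    · rw [indicator_of_notMem hx]; simp
  have hZ : ((conv (J.indicator fun s => Real.cos (η * s)) v t : ℝ) : ℂ) + Complex.I *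
        (conv (J.indicator fun s => Real.sin (η * s)) v t : ℝ) =
      Complex.exp (Complex.I * (η * t : ℝ)) * ∫ s, J.indicator 1 (t - s) *
        ((v s : ℂ) * Complex.exp (-(Complex.I * (inner ℝ s η : ℝ)))) := by
    have h1 := hbd (fun s => Real.cos (η * s)) (by fun_prop) fun _ => Real.abs_cos_le_one _
    have h2 := hbd (fun s => Real.sin (η * s)) (by fun_prop) fun _ => Real.abs_sin_le_one _
    simp only [conv, convolution_eq_swap, ContinuousLinearMap.mul_apply']
    rw [← integral_complex_ofReal, ← integral_complex_ofReal, ← integral_const_mul,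
      ← integral_const_mul, ← integral_add h1.ofReal (h2.ofReal.const_mul _)]
    refine integral_congr_ae (.of_forall fun s => ?_)
    by_cases hx : t - s ∈ J
    · simp only [indicator_of_mem hx, Pi.one_apply]
      have h3 : Complex.exp (Complex.I * (η * t : ℝ)) *
          Complex.exp (-(Complex.I * (inner ℝ s η : ℝ))) =
          (Real.cos (η * (t - s)) : ℂ) + Complex.I * Real.sin (η * (t - s)) := by
        rw [← Complex.exp_add, Complex.ofReal_cos, Complex.ofReal_sin, mul_comm Complex.I (Complex.sin _),
          ← Complex.exp_mul_I]
        congr 1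
        simp
        ring
      push_cast at h3 ⊢
      linear_combination (-(v s : ℂ)) * h3
    · simp only [indicator_of_notMem hx]; simp
  have hint : Integrable fun s => (v s : ℂ) * Complex.exp (-(Complex.I * (inner ℝ s η : ℝ))) := by
    refine hi.ofReal.mul_bdd (c := 1) (Continuous.aestronglyMeasurable (by fun_prop))
      (.of_forall fun x => ?_)
    rw [Complex.norm_exp]; simp
  have hnexp : ∀ s : ℝ, ‖Complex.exp (-(Complex.I * (inner ℝ s η : ℝ)))‖ = 1 := fun s => by
    rw [Complex.norm_exp]; simp
  have hint2 : Integrable fun s => J.indicator 1 (t - s) *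
      ((v s : ℂ) * Complex.exp (-(Complex.I * (inner ℝ s η : ℝ)))) := by
    have hm : Measurable (J.indicator (1 : ℝ → ℂ)) := measurable_one.indicator measurableSet_Icc
    refine hint.bdd_mul (c := 1)
      (hm.comp (measurable_const.sub measurable_id)).aestronglyMeasurable (.of_forall fun s => ?_)
    by_cases hx : t - s ∈ J
    · rw [indicator_of_mem hx]; simp
    · rw [indicator_of_notMem hx]; simp
  rw [hZ, norm_mul, norm_exp_I_mul, one_mul, sub_le_iff_le_add, ← sub_le_iff_le_add']
  refine (norm_sub_norm_le _ _).trans ?_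
  rw [fourierD, ← integral_sub hint hint2, ← integral_indicator measurableSet_Icc.compl]
  refine norm_integral_le_of_norm_le (hi.abs.indicator measurableSet_Icc.compl)
    (.of_forall fun s => ?_)
  by_cases hs : s ∈ Icc (-(N : ℝ)) N
  · have hx : t - s ∈ J := by
      simp only [hJ, mem_Icc] at ht hs ⊢
      constructor <;> linarith [ht.1, ht.2, hs.1, hs.2]
    rw [indicator_of_mem hx]
    simp [hs]
  · rw [indicator_of_mem (show s ∈ (Icc (-(N : ℝ)) N)ᶜ from hs)]
    by_cases hx : t - s ∈ J
    · rw [indicator_of_mem hx]; simp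
    · rw [indicator_of_notMem hx, zero_mul, sub_zero, norm_mul, hnexp]; simp

theorem tendsto_tail {v : ℝ → ℝ} (hi : Integrable v) :
    Tendsto (fun N : ℕ => ∫ s in (Icc (-(N : ℝ)) N)ᶜ, |v s|) atTop (𝓝 0) := by
  have h := tendsto_setIntegral_of_antitone (μ := volume) (f := fun s => |v s|)
    (s := fun N : ℕ => (Icc (-(N : ℝ)) N)ᶜ) (fun N => measurableSet_Icc.compl)
    (fun m n hmn => compl_subset_compl.2 (Icc_subset_Icc (by simpa using hmn) (by simpa using hmn)))
    ⟨0, hi.abs.integrableOn⟩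
  have he : ⋂ N : ℕ, (Icc (-(N : ℝ)) N)ᶜ = ∅ := by
    refine eq_empty_of_forall_notMem fun s hs => ?_
    obtain ⟨N, hN⟩ := exists_nat_ge |s|
    exact mem_iInter.1 hs N (abs_le.1 hN)
  rw [he] at h
  simpa using h

/-- The upper frame bound controls `∑ |v̂_j(η)|²` at every frequency `η`. The constant `4B` (rather
than `B`) comes from comparing an interval of length `2N` with the truncated wave on an interval of
length `4N`, with its real and imaginary parts estimated separately. -/
theorem sum_sq_fourierD_le {v : ℕ → ℝ → ℝ} (hc : ∀ j, Continuous (v j))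
    (hi : ∀ j, Integrable (v j)) {B : ℝ≥0} (hB : ∀ f : ℝ → ℝ, MemLp f 2 volume →
      ∑' j, eLpNorm (conv f (v j)) 2 volume ^ 2 ≤ B * eLpNorm f 2 volume ^ 2) (η : ℝ) (n : ℕ) :
    ∑ j ∈ Finset.range n, ‖fourierD (v j) η‖ ^ 2 ≤ 4 * B := by
  have key : ∀ N : ℕ, 1 ≤ N → ∑ j ∈ Finset.range n,
      ENNReal.ofReal (‖fourierD (v j) η‖ - ∫ s in (Icc (-(N : ℝ)) N)ᶜ, |v j s|) ^ 2 ≤ 4 * B := by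
    intro N hN
    set J := Icc (-(2 * N : ℝ)) (2 * N) with hJ
    obtain ⟨hg1, hn1⟩ := memLp_truncation (a := fun s => Real.cos (η * s)) (by fun_prop)
      (fun _ => Real.abs_cos_le_one _) N
    obtain ⟨hg2, hn2⟩ := memLp_truncation (a := fun s => Real.sin (η * s)) (by fun_prop)
      (fun _ => Real.abs_sin_le_one _) N
    rw [← hJ] at hg1 hn1 hg2 hn2
    set g1 := J.indicator fun s => Real.cos (η * s) with hg1d
    set g2 := J.indicator fun s => Real.sin (η * s) with hg2d
    have hm1 : Measurable g1 := (by fun_prop : Measurable fun s => Real.cos (η * s)).indicator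
      measurableSet_Icc
    have hmeas : ∀ j, Measurable (conv g1 (v j)) := fun j => by
      have hcj := (hc j).measurable
      have : StronglyMeasurable (Function.uncurry fun t s : ℝ => g1 s * v j (t - s)) :=
        Measurable.stronglyMeasurable (by unfold Function.uncurry; fun_prop)
      exact this.integral_prod_right.measurable
    have hlow : ∀ j, ENNReal.ofReal
        (‖fourierD (v j) η‖ - ∫ s in (Icc (-(N : ℝ)) N)ᶜ, |v j s|) ^ 2 * (2 * N) ≤
        eLpNorm (conv g1 (v j)) 2 volume ^ 2 + eLpNorm (conv g2 (v j)) 2 volume ^ 2 := by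
      intro j
      rw [eLpNorm_two_sq, eLpNorm_two_sq, ← lintegral_add_left ((hmeas j).enorm.pow_const 2)]
      have hvol : (volume (Icc (-(N : ℝ)) N) : ℝ≥0∞) = 2 * N := by
        rw [Real.volume_Icc]
        have : (N - -N : ℝ) = ((2 * N : ℕ) : ℝ) := by push_cast; ring
        rw [this, ENNReal.ofReal_natCast]; push_cast; rfl
      rw [← hvol, ← setLIntegral_const]
      refine le_trans (setLIntegral_mono' measurableSet_Icc fun t ht => ?_)
        (setLIntegral_le_lintegral _ _)
      have h1 := norm_fourierD_sub_tail_le (hi j) η N ht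
      have h2 : ‖conv g1 (v j) t‖ₑ ^ 2 + ‖conv g2 (v j) t‖ₑ ^ 2 =
          ENNReal.ofReal ‖((conv g1 (v j) t : ℝ) : ℂ) + Complex.I * (conv g2 (v j) t : ℝ)‖ ^ 2 := by
        rw [← ENNReal.ofReal_pow (norm_nonneg _), ← ofReal_norm, ← ofReal_norm,
          ← ENNReal.ofReal_pow (norm_nonneg _), ← ENNReal.ofReal_pow (norm_nonneg _),
          ← ENNReal.ofReal_add (by positivity) (by positivity), ← Complex.normSq_eq_norm_sq,
          Complex.normSq_apply]
        congr 1
        simp [pow_two]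
      rw [h2]
      gcongr
    have hsum : ∑ j ∈ Finset.range n, (eLpNorm (conv g1 (v j)) 2 volume ^ 2 +
        eLpNorm (conv g2 (v j)) 2 volume ^ 2) ≤ B * (4 * N) + B * (4 * N) := by
      rw [Finset.sum_add_distrib]
      refine add_le_add ?_ ?_
      · exact (ENNReal.sum_le_tsum _).trans ((hB g1 hg1).trans (by gcongr))
      · exact (ENNReal.sum_le_tsum _).trans ((hB g2 hg2).trans (by gcongr))
    have hfin := (Finset.sum_le_sum fun j (_ : j ∈ Finset.range n) => hlow j).trans hsum
    rw [← Finset.sum_mul] at hfin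
    have h3 : (B * (4 * N) + B * (4 * N) : ℝ≥0∞) = 4 * B * (2 * N) := by ring
    rw [h3] at hfin
    have hN0 : (2 * N : ℝ≥0∞) ≠ 0 := by
      have : N ≠ 0 := by omega
      simp [this]
    have hNt : (2 * N : ℝ≥0∞) ≠ ⊤ := ENNReal.mul_ne_top (by simp) (by simp)
    exact (ENNReal.mul_le_mul_iff_left hN0 hNt).1 hfin
  have hlim : Tendsto (fun N : ℕ => ∑ j ∈ Finset.range n,
      ENNReal.ofReal (‖fourierD (v j) η‖ - ∫ s in (Icc (-(N : ℝ)) N)ᶜ, |v j s|) ^ 2) atTop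
      (𝓝 (∑ j ∈ Finset.range n, ENNReal.ofReal ‖fourierD (v j) η‖ ^ 2)) := by
    refine tendsto_finsetSum _ fun j _ => ?_
    have h1 : Tendsto (fun N : ℕ => ‖fourierD (v j) η‖ - ∫ s in (Icc (-(N : ℝ)) N)ᶜ, |v j s|)
        atTop (𝓝 ‖fourierD (v j) η‖) := by
      simpa using (tendsto_tail (hi j)).const_sub ‖fourierD (v j) η‖
    exact ENNReal.Tendsto.pow (ENNReal.tendsto_ofReal h1)
  have hle := le_of_tendsto hlim ((eventually_ge_atTop 1).mono key)
  have h1 : ∑ j ∈ Finset.range n, ENNReal.ofReal ‖fourierD (v j) η‖ ^ 2 =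
      ENNReal.ofReal (∑ j ∈ Finset.range n, ‖fourierD (v j) η‖ ^ 2) := by
    rw [ENNReal.ofReal_sum_of_nonneg fun j _ => by positivity]
    exact Finset.sum_congr rfl fun j _ => (ENNReal.ofReal_pow (norm_nonneg _) 2).symm
  have h2 : (4 * B : ℝ≥0∞) = ENNReal.ofReal (4 * B) := by
    rw [ENNReal.ofReal_mul (by norm_num), ENNReal.ofReal_coe_nnreal]; simp
  rw [h1, h2] at hle
  exact (ENNReal.ofReal_le_ofReal_iff (by positivity)).1 hle

end FrameBound

/-! ### Dilations and Hölder continuity of the Fourier transform -/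

section Scaling

theorem fourierD_dilation (v : ℝ → ℝ) {a : ℝ} (ha : 0 < a) (η : ℝ) :
    fourierD (fun t => a * v (a * t)) η = fourierD v (η / a) := by
  have h := Measure.integral_comp_mul_left
    (fun t : ℝ => (v t : ℂ) * Complex.exp (-(Complex.I * (inner ℝ t (η / a) : ℝ)))) a
  rw [abs_of_pos (inv_pos.2 ha)] at h
  rw [fourierD, fourierD]
  have h2 : ∫ t, ((a * v (a * t) : ℝ) : ℂ) * Complex.exp (-(Complex.I * (inner ℝ t η : ℝ))) =
      (a : ℂ) * ∫ t, (v (a * t) : ℂ) * Complex.exp (-(Complex.I * (inner ℝ (a * t) (η / a) : ℝ))) := by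
    rw [← integral_const_mul]
    refine integral_congr_ae (.of_forall fun t => ?_)
    have h3 : inner ℝ (a * t) (η / a) = inner ℝ t η := by
      simp only [RCLike.inner_apply, conj_trivial]
      field_simp
    simp only [h3]
    push_cast
    ring
  rw [h2, h, Complex.real_smul, ← mul_assoc, ← Complex.ofReal_mul, mul_inv_cancel₀ ha.ne']
  simp

theorem norm_exp_sub_one_le_rpow {δ : ℝ} (h0 : 0 < δ) (h1 : δ ≤ 1) (θ : ℝ) :
    ‖Complex.exp (-(Complex.I * (θ : ℂ))) - 1‖ ≤ 2 * |θ| ^ δ := by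
  have hexp : Complex.exp (-(Complex.I * (θ : ℂ))) = Complex.exp (Complex.I * ((-θ : ℝ) : ℂ)) := by
    congr 1; push_cast; ring
  rw [hexp]
  rcases le_total |θ| 1 with h | h
  · refine (Real.norm_exp_I_mul_ofReal_sub_one_le).trans ?_
    rw [Real.norm_eq_abs, abs_neg]
    have h2 : |θ| ^ (1 : ℝ) ≤ |θ| ^ δ := Real.rpow_le_rpow_of_exponent_ge_of_imp
      (abs_nonneg _) h h1 (fun _ h => absurd h one_ne_zero)
    rw [Real.rpow_one] at h2
    have := Real.rpow_nonneg (abs_nonneg θ) δ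
    linarith
  · have h2 : ‖Complex.exp (Complex.I * ((-θ : ℝ) : ℂ)) - 1‖ ≤ 2 := by
      refine (norm_sub_le _ _).trans ?_
      rw [norm_exp_I_mul]; norm_num
    have h3 : 1 ≤ |θ| ^ δ := Real.one_le_rpow h h0.le
    linarith

/-- Decay of `v` gives a Hölder bound for its Fourier transform at the origin. -/
theorem exists_holder_fourierD {v : ℝ → ℝ} (hc : Continuous v) {C ε : ℝ} (hε : 0 < ε)
    (hdec : ∀ t, |v t| ≤ C * (1 + |t|) ^ (-(1 + ε))) :
    ∃ δ M : ℝ, 0 < δ ∧ δ ≤ 1 ∧ 0 ≤ M ∧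
      ∀ η, ‖fourierD v η - fourierD v 0‖ ≤ M * |η| ^ δ := by
  set δ : ℝ := min (ε / 2) 1 with hδ
  have hδ0 : 0 < δ := lt_min (by linarith) one_pos
  have hδ1 : δ ≤ 1 := min_le_right _ _
  have hδε : δ ≤ ε / 2 := min_le_left _ _
  have hC : 0 ≤ C := by simpa using (abs_nonneg _).trans (hdec 0)
  have hi : Integrable v := ((integrable_one_add_abs_rpow hε).const_mul C).mono'
    hc.aestronglyMeasurable (.of_forall hdec)
  have hG : Integrable fun t : ℝ => 2 * (C * (1 + |t|) ^ (-(1 + (ε - δ)))) :=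
    ((integrable_one_add_abs_rpow (by linarith)).const_mul C).const_mul 2
  refine ⟨δ, ∫ t, 2 * (C * (1 + |t|) ^ (-(1 + (ε - δ)))), hδ0, hδ1,
    integral_nonneg fun t => by positivity, fun η => ?_⟩
  have hint : ∀ η, Integrable fun s =>
      (v s : ℂ) * Complex.exp (-(Complex.I * (inner ℝ s η : ℝ))) := by
    intro η
    refine hi.ofReal.mul_bdd (c := 1) (Continuous.aestronglyMeasurable (by fun_prop))
      (.of_forall fun x => ?_)
    rw [Complex.norm_exp]; simp
  rw [fourierD, fourierD, ← integral_sub (hint η) (hint 0), ← integral_mul_const]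
  refine norm_integral_le_of_norm_le (hG.mul_const _) (.of_forall fun s => ?_)
  simp only [inner_zero_right, Complex.ofReal_zero, mul_zero, neg_zero, Complex.exp_zero]
  rw [← mul_sub, norm_mul, Complex.norm_real, Real.norm_eq_abs]
  have h1 := norm_exp_sub_one_le_rpow hδ0 hδ1 (inner ℝ s η)
  have h2 : |inner ℝ s η| ^ δ = |s| ^ δ * |η| ^ δ := by
    simp only [RCLike.inner_apply, conj_trivial]
    rw [abs_mul, Real.mul_rpow (abs_nonneg _) (abs_nonneg _), mul_comm]
  rw [h2] at h1
  have h3 : (1 + |s|) ^ (-(1 + ε)) * |s| ^ δ ≤ (1 + |s|) ^ (-(1 + (ε - δ))) := by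
    have h4 : (1 + |s|) ^ (-(1 + (ε - δ))) = (1 + |s|) ^ (-(1 + ε)) * (1 + |s|) ^ δ := by
      rw [← Real.rpow_add (by positivity)]; congr 1; ring
    rw [h4]
    refine mul_le_mul_of_nonneg_left ?_ (by positivity)
    exact Real.rpow_le_rpow (abs_nonneg _) (by linarith) hδ0.le
  calc |v s| * ‖Complex.exp (-(Complex.I * (inner ℝ s η : ℝ))) - 1‖
      ≤ (C * (1 + |s|) ^ (-(1 + ε))) * (2 * (|s| ^ δ * |η| ^ δ)) :=
        mul_le_mul (hdec s) h1 (norm_nonneg _) (by positivity)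
    _ = 2 * (C * ((1 + |s|) ^ (-(1 + ε)) * |s| ^ δ)) * |η| ^ δ := by ring
    _ ≤ 2 * (C * (1 + |s|) ^ (-(1 + (ε - δ)))) * |η| ^ δ := by gcongr

end Scaling

/-! ### The distribution with a given bounded Fourier transform -/

section MultiplierDistribution

variable {E : Type*} [NormedAddCommGroup E] [InnerProductSpace ℝ E] [FiniteDimensional ℝ E]
  [MeasurableSpace E] [BorelSpace E]

theorem fourierInvD_eq_const_mul (φ : E → ℂ) (ξ : E) :
    fourierInvD φ ξ = ((((2 * Real.pi : ℝ) ^ Module.finrank ℝ E : ℝ)⁻¹ : ℝ) : ℂ) *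
      𝓕⁻ φ ((2 * Real.pi)⁻¹ • ξ) := by
  rw [fourierInvD, Real.fourierInv_eq']
  congr 1
  refine integral_congr_ae (.of_forall fun x => ?_)
  simp only [smul_eq_mul, inner_smul_right]
  rw [mul_comm]
  congr 2
  push_cast
  have : (Real.pi : ℂ) ≠ 0 := by exact_mod_cast Real.pi_ne_zero
  field_simp

theorem integrable_fourierInvD (φ : 𝓢(E, ℂ)) : Integrable (fourierInvD φ) := by
  have h0 : (2 * Real.pi)⁻¹ ≠ (0 : ℝ) := by positivity
  have h1 : Integrable (𝓕⁻ (φ : E → ℂ)) := by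
    rw [← SchwartzMap.fourierInv_coe]; exact SchwartzMap.integrable _
  have h2 : fourierInvD (φ : E → ℂ) = fun ξ =>
      ((((2 * Real.pi : ℝ) ^ Module.finrank ℝ E : ℝ)⁻¹ : ℝ) : ℂ) *
      𝓕⁻ (φ : E → ℂ) ((2 * Real.pi)⁻¹ • ξ) := funext (fourierInvD_eq_const_mul _)
  rw [h2]
  exact (h1.comp_smul h0).const_mul _

/-- The inverse Fourier transform of a bounded function is a tempered distribution. -/
theorem exists_isInverseFourier {m : E → ℝ} (hm : Measurable m) {K : ℝ} (hK : ∀ ξ, |m ξ| ≤ K) :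
    ∃ Φ : 𝓢'(E, ℂ), IsInverseFourier m Φ := by
  have hpi : (2 * Real.pi) ≠ (0 : ℝ) := by positivity
  have hL : MemLp (fun η : E => ((m ((2 * Real.pi) • η) : ℝ) : ℂ)) ∞ volume := by
    refine memLp_top_of_bound (C := K) (Measurable.aestronglyMeasurable (by fun_prop))
      (.of_forall fun η => ?_)
    rw [Complex.norm_real]
    exact hK _
  refine ⟨𝓕⁻ (Lp.toTemperedDistribution (hL.toLp _)), fun φ => ⟨?_, ?_⟩⟩
  · refine (integrable_fourierInvD φ).bdd_mul (c := K)
      (Measurable.aestronglyMeasurable (by fun_prop)) (.of_forall fun η => ?_)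
    rw [Complex.norm_real]
    exact hK _
  · rw [TemperedDistribution.fourierInv_apply, Lp.toTemperedDistribution_apply]
    have h1 : ∫ x, (𝓕⁻ φ : 𝓢(E, ℂ)) x • (hL.toLp _) x =
        ∫ η, 𝓕⁻ (φ : E → ℂ) ((2 * Real.pi)⁻¹ • ((2 * Real.pi) • η)) *
          ((m ((2 * Real.pi) • η) : ℝ) : ℂ) := by
      refine integral_congr_ae ?_
      filter_upwards [hL.coeFn_toLp] with x hx
      rw [hx, smul_smul, inv_mul_cancel₀ hpi, one_smul, SchwartzMap.fourierInv_coe, smul_eq_mul]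
    rw [h1, Measure.integral_comp_smul (volume : Measure E) (fun ξ =>
      𝓕⁻ (φ : E → ℂ) ((2 * Real.pi)⁻¹ • ξ) * ((m ξ : ℝ) : ℂ)) (2 * Real.pi),
      abs_of_nonneg (by positivity), Complex.real_smul, ← integral_const_mul]
    refine integral_congr_ae (.of_forall fun ξ => ?_)
    simp only [fourierInvD_eq_const_mul]
    ring

/-- Convolution with the inverse Fourier transform of `m` is the Fourier multiplier `m`. -/
theorem distConv_eq_fourierInvD {m : E → ℝ} {Φ : 𝓢'(E, ℂ)} (hΦ : IsInverseFourier m Φ)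
    {f : E → ℝ} (hf : ContDiff ℝ ∞ f) (hc : HasCompactSupport f) (x : E) :
    distConv Φ (testFunction f hf hc) x = fourierInvD (fun ξ => (m ξ : ℂ) * fourierD f ξ) x := by
  rw [distConv, (hΦ _).2]
  simp only [fourierInvD]
  rw [← integral_const_mul]
  refine integral_congr_ae (.of_forall fun ξ => ?_)
  have h1 : ∫ y, reflTranslate x (testFunction f hf hc) y *
      Complex.exp (Complex.I * (inner ℝ y ξ : ℝ)) =
      fourierD f ξ * Complex.exp (Complex.I * (inner ℝ ξ x : ℝ)) := by
    rw [fourierD, ← integral_mul_const,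
      ← integral_sub_left_eq_self (fun y => (f y : ℂ) * _ * _) volume x]
    refine integral_congr_ae (.of_forall fun y => ?_)
    simp only [reflTranslate_apply, testFunction_apply]
    rw [mul_assoc, ← Complex.exp_add]
    congr 2
    rw [inner_sub_left, real_inner_comm ξ x]
    push_cast
    ring
  simp only [h1]
  ring

end MultiplierDistribution

/-! ### Convolution in time of solutions of the wave equation -/

section TimeConvolution

theorem integral_mul_cos_eq {v : ℝ → ℝ} (hi : Integrable v) (heven : v.Even) (a t : ℝ) :
    ∫ s, (v s : ℂ) * (Real.cos (a * (t - s)) : ℂ) = (Real.cos (a * t) : ℂ) * fourierD v a := by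
  have hint : ∀ b : ℝ, Integrable fun s =>
      (v s : ℂ) * Complex.exp (-(Complex.I * (inner ℝ s b : ℝ))) := by
    intro b
    refine hi.ofReal.mul_bdd (c := 1) (Continuous.aestronglyMeasurable (by fun_prop))
      (.of_forall fun x => ?_)
    rw [Complex.norm_exp]; simp
  have hneg : fourierD v (-a) = fourierD v a := by
    rw [fourierD, fourierD, ← integral_neg_eq_self]
    refine integral_congr_ae (.of_forall fun s => ?_)
    simp [heven s]
  have h1 : ∀ s : ℝ, (v s : ℂ) * (Real.cos (a * (t - s)) : ℂ) =
      Complex.exp ((a * t : ℝ) * Complex.I) / 2 *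
        ((v s : ℂ) * Complex.exp (-(Complex.I * (inner ℝ s a : ℝ)))) +
      Complex.exp (-((a * t : ℝ) : ℂ) * Complex.I) / 2 *
        ((v s : ℂ) * Complex.exp (-(Complex.I * (inner ℝ s (-a) : ℝ)))) := by
    intro s
    rw [Complex.ofReal_cos, Complex.cos]
    have e1 : Complex.exp (((a * (t - s) : ℝ) : ℂ) * Complex.I) =
        Complex.exp ((a * t : ℝ) * Complex.I) *
          Complex.exp (-(Complex.I * (inner ℝ s a : ℝ))) := by
      rw [← Complex.exp_add]; congr 1; simp; ring
    have e2 : Complex.exp (-((a * (t - s) : ℝ) : ℂ) * Complex.I) =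
        Complex.exp (-((a * t : ℝ) : ℂ) * Complex.I) *
          Complex.exp (-(Complex.I * (inner ℝ s (-a) : ℝ))) := by
      rw [← Complex.exp_add]; congr 1; simp; ring
    rw [e1, e2]; ring
  simp only [h1]
  rw [integral_add ((hint a).const_mul _) ((hint (-a)).const_mul _), integral_const_mul,
    integral_const_mul]
  change _ * fourierD v a + _ * fourierD v (-a) = _
  rw [hneg, Complex.ofReal_cos, Complex.cos]
  ring

variable {E : Type*} [NormedAddCommGroup E] [InnerProductSpace ℝ E] [FiniteDimensional ℝ E]
  [MeasurableSpace E] [BorelSpace E]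

theorem norm_waveSol_le {h : E → ℂ} (hh : Integrable h) (z : E × ℝ) : ‖waveSol h z‖ ≤
    ((2 * Real.pi : ℝ) ^ Module.finrank ℝ E : ℝ)⁻¹ * ∫ ξ, ‖h ξ‖ := by
  refine (Complex.abs_re_le_norm _).trans ?_
  rw [fourierInvD, norm_mul, Complex.norm_real, Real.norm_of_nonneg (by positivity)]
  refine mul_le_mul_of_nonneg_left (norm_integral_le_of_norm_le hh.norm (.of_forall fun ξ => ?_))
    (by positivity)
  rw [norm_mul, norm_exp_I_mul, mul_one, norm_mul, Complex.norm_real]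
  exact mul_le_of_le_one_left (norm_nonneg _) (Real.abs_cos_le_one _)

/-- Convolving the solution in time with an even function `v` multiplies its initial data by
`v̂(‖ξ‖)`. -/
theorem integral_mul_waveSol {v : ℝ → ℝ} (hi : Integrable v) (heven : v.Even) {h : E → ℂ}
    (hh : Integrable h) (x : E) (t : ℝ) :
    ∫ s, v s * waveSol h (x, t - s) = waveSol (fun ξ => fourierD v ‖ξ‖ * h ξ) (x, t) := by
  set c : ℝ := ((2 * Real.pi : ℝ) ^ Module.finrank ℝ E : ℝ)⁻¹
  have hprod : Integrable (fun z : ℝ × E => (v z.1 : ℂ) * ((Real.cos (‖z.2‖ * (t - z.1)) : ℂ) *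
      h z.2 * Complex.exp (Complex.I * (inner ℝ z.2 x : ℝ)))) (volume.prod volume) := by
    have h1 := (hi.ofReal (𝕜 := ℂ)).mul_prod hh
    have h2 : Integrable (fun z : ℝ × E => ((Real.cos (‖z.2‖ * (t - z.1)) : ℂ) *
        Complex.exp (Complex.I * (inner ℝ z.2 x : ℝ))) * ((v z.1 : ℂ) * h z.2))
        (volume.prod volume) := by
      refine h1.bdd_mul (c := 1) (Continuous.aestronglyMeasurable (by fun_prop))
        (.of_forall fun z => ?_)
      rw [norm_mul, norm_exp_I_mul, mul_one, Complex.norm_real]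
      exact Real.abs_cos_le_one _
    refine h2.congr (.of_forall fun z => ?_)
    simp only
    ring
  have h1 : ∀ s, v s * waveSol h (x, t - s) = Complex.re (c * ∫ ξ, (v s : ℂ) *
      ((Real.cos (‖ξ‖ * (t - s)) : ℂ) * h ξ * Complex.exp (Complex.I * (inner ℝ ξ x : ℝ)))) := by
    intro s
    rw [waveSol, fourierInvD, ← Complex.re_ofReal_mul, integral_const_mul]
    congr 1
    ring
  simp only [h1]
  have h2 : Integrable fun s => (c : ℂ) * ∫ ξ, (v s : ℂ) *
      ((Real.cos (‖ξ‖ * (t - s)) : ℂ) * h ξ * Complex.exp (Complex.I * (inner ℝ ξ x : ℝ))) :=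
    hprod.integral_prod_left.const_mul _
  have h3 := integral_re h2
  simp only [RCLike.re_to_complex] at h3
  rw [h3, integral_const_mul, integral_integral_swap hprod, waveSol, fourierInvD]
  congr 2
  refine integral_congr_ae (.of_forall fun ξ => ?_)
  simp only
  have h4 := integral_mul_cos_eq hi heven ‖ξ‖ t
  have h5 : ∀ s, (v s : ℂ) * ((Real.cos (‖ξ‖ * (t - s)) : ℂ) * h ξ *
      Complex.exp (Complex.I * (inner ℝ ξ x : ℝ))) = ((v s : ℂ) * (Real.cos (‖ξ‖ * (t - s)) : ℂ)) *
      (h ξ * Complex.exp (Complex.I * (inner ℝ ξ x : ℝ))) := fun s => by ring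
  simp only [h5]
  rw [integral_mul_const, h4]
  ring

end TimeConvolution

/-! ### Geometric decay along the scales -/

section MultiscaleDecay

/-- The scaling structure forces geometric decay of `|v̂_j|²` in `j`: summability makes `v̂_1`
vanish at the origin, and `v̂_j(η) = v̂_1(2^{1-j} η)` for `j ≥ 1`. -/
theorem exists_geometric_bound {v : ℕ → ℝ → ℝ} (hc : ∀ j, Continuous (v j)) {w : ℝ → ℝ}
    (hw : ∀ j, 1 ≤ j → ∀ x, v j x = 2 ^ j * w (2 ^ j * x)) {C ε : ℝ} (hε : 0 < ε)
    (hdec : ∀ t, |v 1 t| ≤ C * (1 + |t|) ^ (-(1 + ε))) {K : ℝ}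
    (hK : ∀ (η : ℝ) (n : ℕ), ∑ j ∈ Finset.range n, ‖fourierD (v j) η‖ ^ 2 ≤ K) :
    ∃ D q : ℝ, 0 ≤ D ∧ 0 < q ∧ q < 1 ∧
      ∀ j η, ‖fourierD (v j) η‖ ^ 2 ≤ D * q ^ j * (1 + η ^ 2) := by
  have hi1 : Integrable (v 1) := ((integrable_one_add_abs_rpow hε).const_mul C).mono'
    (hc 1).aestronglyMeasurable (.of_forall hdec)
  have hscale : ∀ j η, fourierD (v (j + 1)) η = fourierD (v 1) (η / 2 ^ j) := by
    intro j η
    rw [← fourierD_dilation (v 1) (by positivity : (0 : ℝ) < 2 ^ j)]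
    congr 1
    ext t
    have e : (2 : ℝ) ^ (j + 1) * t = 2 ^ 1 * (2 ^ j * t) := by ring
    rw [hw (j + 1) (by omega) t, hw 1 le_rfl (2 ^ j * t), e]
    ring
  have hsummable : ∀ η, Summable fun j => ‖fourierD (v j) η‖ ^ 2 := fun η =>
    summable_of_sum_range_le (fun j => by positivity) (hK η)
  have hK0 : 0 ≤ K := by simpa using hK 0 0
  have hzero : fourierD (v 1) 0 = 0 := by
    have h1 : Tendsto (fun j : ℕ => ‖fourierD (v 1) (1 / 2 ^ j)‖ ^ 2) atTop (𝓝 0) :=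
      ((tendsto_add_atTop_iff_nat 1).2 (hsummable 1).tendsto_atTop_zero).congr fun j => by
        rw [hscale j 1]
    have h2 : Tendsto (fun j : ℕ => (1 : ℝ) / 2 ^ j) atTop (𝓝 0) := by
      simpa using tendsto_pow_atTop_nhds_zero_of_lt_one (r := (1 / 2 : ℝ)) (by norm_num)
        (by norm_num)
    have h3 := (((continuous_fourierD hi1).norm.pow 2).tendsto 0).comp h2
    have h4 := tendsto_nhds_unique h1 h3
    simpa using h4.symm
  obtain ⟨δ, M, hδ0, hδ1, hM0, hM⟩ := exists_holder_fourierD (hc 1) hε hdec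
  simp only [hzero, sub_zero] at hM
  set q : ℝ := (1 / 4) ^ δ with hq
  have hq0 : 0 < q := by positivity
  have hq1 : q < 1 := Real.rpow_lt_one (by norm_num) (by norm_num) hδ0
  refine ⟨K + M ^ 2 / q, q, by positivity, hq0, hq1, fun j η => ?_⟩
  rcases j with _ | j
  · have h1 := hK η 1
    simp only [Finset.sum_range_one] at h1
    have h2 : 0 ≤ M ^ 2 / q := by positivity
    nlinarith [sq_nonneg η]
  · have h2 : (|η / 2 ^ j| ^ δ) ^ 2 = (η ^ 2) ^ δ * q ^ j := by
      rw [hq, ← Real.rpow_natCast, ← Real.rpow_mul (abs_nonneg _), mul_comm δ,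
        Real.rpow_mul (abs_nonneg _), Real.rpow_natCast, sq_abs, div_pow,
        Real.div_rpow (by positivity) (by positivity), ← Real.rpow_natCast ((1 / 4 : ℝ) ^ δ) j,
        ← Real.rpow_mul (by norm_num), mul_comm δ, Real.rpow_mul (by norm_num),
        Real.rpow_natCast, div_eq_mul_inv]
      congr 1
      rw [← Real.inv_rpow (by positivity)]
      congr 1
      rw [one_div, inv_pow]
      congr 1
      rw [← pow_mul, mul_comm, pow_mul]
      norm_num
    have h3 : (η ^ 2) ^ δ ≤ 1 + η ^ 2 := by
      calc (η ^ 2) ^ δ ≤ (1 + η ^ 2) ^ δ :=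
            Real.rpow_le_rpow (by positivity) (by linarith) hδ0.le
        _ ≤ (1 + η ^ 2) ^ (1 : ℝ) :=
            Real.rpow_le_rpow_of_exponent_le (by nlinarith [sq_nonneg η]) hδ1
        _ = 1 + η ^ 2 := Real.rpow_one _
    rw [hscale]
    calc ‖fourierD (v 1) (η / 2 ^ j)‖ ^ 2 ≤ (M * |η / 2 ^ j| ^ δ) ^ 2 := by
          gcongr; exact hM _
      _ = M ^ 2 * q ^ j * (η ^ 2) ^ δ := by rw [mul_pow, h2]; ring
      _ ≤ M ^ 2 * q ^ j * (1 + η ^ 2) := by gcongr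
      _ = (M ^ 2 / q) * q ^ (j + 1) * (1 + η ^ 2) := by
          rw [pow_succ]; field_simp; ring
      _ ≤ (K + M ^ 2 / q) * q ^ (j + 1) * (1 + η ^ 2) := by
          gcongr; linarith

end MultiscaleDecay

/-! ### Fourier multipliers on test functions -/

section Series

variable {E : Type*} [NormedAddCommGroup E] [InnerProductSpace ℝ E] [FiniteDimensional ℝ E]
  [MeasurableSpace E] [BorelSpace E]

theorem memLp_weight_mul_schwartz (T : 𝓢(E, ℂ)) :
    MemLp (fun ξ => ((1 + ‖ξ‖ ^ 2 : ℝ) : ℂ) * T ξ) 2 volume := by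
  have hg : (fun ξ : E => ((1 + ‖ξ‖ ^ 2 : ℝ) : ℂ)).HasTemperateGrowth := by
    fun_prop
  have h := (SchwartzMap.smulLeftCLM ℂ (fun ξ : E => ((1 + ‖ξ‖ ^ 2 : ℝ) : ℂ)) T).memLp 2 volume
  refine (memLp_congr_ae (.of_forall fun ξ => ?_)).1 h
  rw [SchwartzMap.smulLeftCLM_apply_apply hg, smul_eq_mul]

/-- A multiplier dominated by `R (1 + ‖ξ‖²)` maps test functions to `L²`, with norm controlled by
`R`. -/
theorem eLpNorm_multiplier_le (T : 𝓢(E, ℂ)) {a : E → ℝ} (ha : Measurable a) {K R : ℝ}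
    (hK : ∀ ξ, |a ξ| ≤ K) (hR : ∀ ξ, |a ξ| ≤ R * (1 + ‖ξ‖ ^ 2)) :
    MemLp (fourierInvD fun ξ => (a ξ : ℂ) * T ξ) 2 volume ∧
      eLpNorm (fourierInvD fun ξ => (a ξ : ℂ) * T ξ) 2 volume ≤
        ENNReal.ofReal R * eLpNorm (fun ξ : E => ((1 + ‖ξ‖ ^ 2 : ℝ) : ℂ) * T ξ) 2 volume := by
  have hm : AEStronglyMeasurable (fun ξ => (a ξ : ℂ)) (volume : Measure E) :=
    Measurable.aestronglyMeasurable (by fun_prop)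
  have h1 : Integrable fun ξ => (a ξ : ℂ) * T ξ :=
    T.integrable.bdd_mul (c := K) hm (.of_forall fun ξ => by rw [Complex.norm_real]; exact hK ξ)
  have hle : ∀ ξ, ‖(a ξ : ℂ) * T ξ‖ ≤ R * ‖((1 + ‖ξ‖ ^ 2 : ℝ) : ℂ) * T ξ‖ := by
    intro ξ
    rw [norm_mul, norm_mul, Complex.norm_real, Complex.norm_real, ← mul_assoc,
      Real.norm_of_nonneg (by positivity : (0 : ℝ) ≤ 1 + ‖ξ‖ ^ 2)]
    exact mul_le_mul_of_nonneg_right (hR ξ) (norm_nonneg _)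
  have h2 := eLpNorm_le_mul_eLpNorm_of_ae_le_mul (μ := (volume : Measure E)) (.of_forall hle) 2
  have hL : MemLp (fun ξ => (a ξ : ℂ) * T ξ) 2 volume :=
    ⟨h1.1, h2.trans_lt (ENNReal.mul_lt_top ENNReal.ofReal_lt_top (memLp_weight_mul_schwartz T).2)⟩
  obtain ⟨h3, h4⟩ := eLpNorm_fourierInvD_le h1 hL
  exact ⟨h3, h4.trans h2⟩

end Series

end MultiscalePAT

theorem corollary3p8 {d : ℕ} (hd : 1 ≤ d) (v : ℕ → ℝ → ℝ)
    (hv : IsMultiscaleDecomposition v)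
    (heven : ∀ j, (v j).Even)
    (hsmooth : ∀ j, ContDiff ℝ ((d / 2 : ℕ) : WithTop ℕ∞) (v j))
    (hdecay : ∀ j, HasSufficientDecay d (v j))
    (u : ℕ → EuclideanSpace ℝ (Fin d) → ℝ)
    (hu : ∀ j, u j = radonSharp d (v j)) :
    -- the filters are integrable and `∑ |F u_j|²` converges almost everywhere
    (∀ j, Integrable (u j) volume) ∧
    (∀ᵐ ξ, Summable fun j => ‖fourierD (u j) ξ‖ ^ 2) ∧
    -- `Φ = F⁻¹ (∑ |F u_j|²)` is a tempered distribution
    ∃ Φ : 𝓢'(EuclideanSpace ℝ (Fin d), ℂ),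
      IsInverseFourier (fun ξ => ∑' j, ‖fourierD (u j) ξ‖ ^ 2) Φ ∧
      ∀ (f : EuclideanSpace ℝ (Fin d) → ℝ) (hf : ContDiff ℝ ∞ f) (hc : HasCompactSupport f),
        -- `Φ ⊛ f = ∑ u_j^* ⊛ f_j`, the series converging absolutely in `L²`
        ((∀ j, MemLp (conv (reflect (u j)) (conv (u j) f)) 2 volume) ∧
          ∑' j, eLpNorm (conv (reflect (u j)) (conv (u j) f)) 2 volume < ⊤ ∧
          Tendsto (fun n : ℕ => eLpNorm (fun x => distConv Φ (testFunction f hf hc) x -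
              ((∑ j ∈ Finset.range n, conv (reflect (u j)) (conv (u j) f) x : ℝ) : ℂ)) 2 volume)
            atTop (𝓝 0)) ∧
        -- `W f_j = v_j ⊛_t W f`
        IsWellPosed f ∧
        ∀ j, IsWellPosed (conv (u j) f) ∧
          ∀ S : Set (EuclideanSpace ℝ (Fin d)),
            (∀ z : S, ∀ t : ℝ, ConvolutionExistsAt (v j)
              (evenExt fun τ => waveOp S f (z, τ)) t (ContinuousLinearMap.mul ℝ ℝ) volume) ∧
            waveOp S (conv (u j) f) = timeConv (v j) (waveOp S f) := by
  obtain ⟨⟨hmem, A, B, -, -, hframe⟩, w, -, -, hscale⟩ := hv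
  have hvc : ∀ j, Continuous (v j) := fun j => (hsmooth j).continuous
  have hvi : ∀ j, Integrable (v j) := fun j => memLp_one_iff_integrable.1 (hmem j).1
  have hspec : ∀ j, Integrable (u j) ∧ ∀ ξ, fourierD (u j) ξ = fourierD (v j) ‖ξ‖ := fun j => by
    rw [hu j]; exact radonSharp_spec hd (heven j) (hsmooth j) (hdecay j)
  have hui := fun j => (hspec j).1
  have huc := fun j => continuous_fourierD (hui j)
  have hK : ∀ (η : ℝ) (n : ℕ), ∑ j ∈ Finset.range n, ‖fourierD (v j) η‖ ^ 2 ≤ 4 * B :=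
    sum_sq_fourierD_le hvc hvi fun f hf => (hframe f hf).2
  -- the decay of `v 1` suffices, since the other scales `j ≥ 1` are its dilates
  obtain ⟨C, ε, hε, hdec⟩ := hdecay 1
  obtain ⟨D, q, hD0, hq0, hq1, hgeo⟩ := exists_geometric_bound hvc (w := w)
    (fun j hj x => by simpa using hscale j hj x) hε
    (fun t => by simpa [iteratedDeriv_zero] using hdec 0 (Nat.zero_le _) t) hK
  have hKu : ∀ ξ n, ∑ j ∈ Finset.range n, ‖fourierD (u j) ξ‖ ^ 2 ≤ 4 * B := fun ξ n => by
    simpa only [(hspec _).2] using hK ‖ξ‖ n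
  have hsum : ∀ ξ, Summable fun j => ‖fourierD (u j) ξ‖ ^ 2 := fun ξ =>
    summable_of_sum_range_le (fun j => by positivity) (hKu ξ)
  have hgeou : ∀ j ξ, ‖fourierD (u j) ξ‖ ^ 2 ≤ D * q ^ j * (1 + ‖ξ‖ ^ 2) := fun j ξ => by
    rw [(hspec j).2]; exact hgeo j ‖ξ‖
  have hgs : Summable fun j => D * q ^ j := (summable_geometric_of_lt_one hq0.le hq1).mul_left D
  set m : EuclideanSpace ℝ (Fin d) → ℝ := fun ξ => ∑' j, ‖fourierD (u j) ξ‖ ^ 2 with hm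
  have hpart : ∀ n, Measurable fun ξ => ∑ j ∈ Finset.range n, ‖fourierD (u j) ξ‖ ^ 2 := fun n =>
    (continuous_finsetSum _ fun j _ => (huc j).norm.pow 2).measurable
  have hmm : Measurable m := measurable_of_tendsto_metrizable hpart
    (tendsto_pi_nhds.2 fun ξ => (hsum ξ).hasSum.tendsto_sum_nat)
  have hm0 : ∀ ξ, 0 ≤ m ξ := fun ξ => tsum_nonneg fun j => by positivity
  have hmK : ∀ ξ, |m ξ| ≤ 4 * B := fun ξ => by
    rw [abs_of_nonneg (hm0 ξ)]
    exact Real.tsum_le_of_sum_range_le (fun j => by positivity) (hKu ξ)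
  obtain ⟨Φ, hΦ⟩ := exists_isInverseFourier hmm hmK
  refine ⟨hui, .of_forall hsum, Φ, hΦ, fun f hf hc => ?_⟩
  obtain ⟨T, hT⟩ := exists_schwartz_eq_fourierD hf hc
  have hT' : fourierD f = T := funext hT
  have hfT : ∀ x, (f x : ℂ) = fourierInvD T x := fun x => by
    rw [← hT', fourierInvD_fourierD hf hc]
  have hubd : ∀ j ξ, ‖fourierD (u j) ξ‖ ≤ ∫ x, |u j x| := fun j => norm_fourierD_le (u j)
  have hjint : ∀ j, Integrable fun ξ => fourierD (u j) ξ * T ξ := fun j =>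
    T.integrable.bdd_mul (huc j).aestronglyMeasurable (.of_forall (hubd j))
  have hfj : ∀ j x, (conv (u j) f x : ℂ) = fourierInvD (fun ξ => fourierD (u j) ξ * T ξ) x :=
    fun j => conv_eq_fourierInvD (hui j) T.integrable hfT
  have hgj : ∀ j x, (conv (reflect (u j)) (conv (u j) f) x : ℂ) =
      fourierInvD (fun ξ => ((‖fourierD (u j) ξ‖ ^ 2 : ℝ) : ℂ) * T ξ) x := by
    intro j x
    have hr : Integrable (reflect (u j)) := (hui j).comp_neg
    rw [conv_eq_fourierInvD hr (hjint j) (hfj j)]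
    congr 1
    ext ξ
    rw [fourierD_reflect, ← mul_assoc, Complex.conj_mul']
    push_cast
    rfl
  have hsingle : ∀ j ξ, |‖fourierD (u j) ξ‖ ^ 2| ≤ 4 * B := fun j ξ => by
    rw [abs_of_nonneg (by positivity)]
    exact (Finset.single_le_sum (f := fun j => ‖fourierD (u j) ξ‖ ^ 2)
      (fun i _ => by positivity) (Finset.self_mem_range_succ j)).trans (hKu ξ (j + 1))
  have hterm : ∀ j, MemLp (conv (reflect (u j)) (conv (u j) f)) 2 volume ∧
      eLpNorm (conv (reflect (u j)) (conv (u j) f)) 2 volume ≤ ENNReal.ofReal (D * q ^ j) *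
        eLpNorm (fun ξ : EuclideanSpace ℝ (Fin d) => ((1 + ‖ξ‖ ^ 2 : ℝ) : ℂ) * T ξ) 2 volume := by
    intro j
    obtain ⟨h1, h2⟩ := eLpNorm_multiplier_le T (a := fun ξ => ‖fourierD (u j) ξ‖ ^ 2)
      ((huc j).norm.pow 2).measurable (hsingle j) (R := D * q ^ j) (fun ξ => by rw [abs_of_nonneg (by positivity)]; exact hgeou j ξ)
    rw [← funext (hgj j)] at h1 h2
    have h3 : conv (reflect (u j)) (conv (u j) f) =
        fun x => ((conv (reflect (u j)) (conv (u j) f) x : ℝ) : ℂ).re := rfl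
    refine ⟨by rw [h3]; exact h1.re, le_trans (le_of_eq (eLpNorm_congr_norm_ae ?_)) h2⟩
    exact .of_forall fun x => (Complex.norm_real _).symm
  have hTlt := (memLp_weight_mul_schwartz T).2
  refine ⟨⟨fun j => (hterm j).1, ?_, ?_⟩, ?_⟩
  · refine (ENNReal.tsum_le_tsum fun j => (hterm j).2).trans_lt ?_
    rw [ENNReal.tsum_mul_right]
    exact ENNReal.mul_lt_top hgs.tsum_ofReal_lt_top hTlt
  · -- the remainder is the Fourier multiplier by the tail of the series, which is `O(qⁿ)`
    have hdiff : ∀ n x, distConv Φ (testFunction f hf hc) x -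
        ((∑ j ∈ Finset.range n, conv (reflect (u j)) (conv (u j) f) x : ℝ) : ℂ) =
        fourierInvD (fun ξ =>
          ((m ξ - ∑ j ∈ Finset.range n, ‖fourierD (u j) ξ‖ ^ 2 : ℝ) : ℂ) * T ξ) x := by
      intro n x
      have hi1 : Integrable fun ξ => (m ξ : ℂ) * T ξ :=
        T.integrable.bdd_mul (c := 4 * B) (Measurable.aestronglyMeasurable (by fun_prop))
          (.of_forall fun ξ => by rw [Complex.norm_real]; exact hmK ξ)
      have hi2 : ∀ j, Integrable fun ξ => ((‖fourierD (u j) ξ‖ ^ 2 : ℝ) : ℂ) * T ξ := fun j =>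
        T.integrable.bdd_mul (c := 4 * B)
          (Complex.continuous_ofReal.comp ((huc j).norm.pow 2)).aestronglyMeasurable
          (.of_forall fun ξ => by rw [Complex.norm_real]; exact hsingle j ξ)
      rw [distConv_eq_fourierInvD hΦ hf hc, hT', Complex.ofReal_sum]
      simp only [hgj]
      rw [← fourierInvD_sum _ fun j _ => hi2 j,
        ← fourierInvD_sub hi1 (integrable_finsetSum _ fun j _ => hi2 j)]
      congr 1
      ext ξ
      rw [← Finset.sum_mul, ← sub_mul]
      push_cast
      rfl
    have htail : ∀ n ξ, |m ξ - ∑ j ∈ Finset.range n, ‖fourierD (u j) ξ‖ ^ 2| ≤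
        (∑' j, D * q ^ (j + n)) * (1 + ‖ξ‖ ^ 2) := by
      intro n ξ
      have hmξ : m ξ = ∑ j ∈ Finset.range n, ‖fourierD (u j) ξ‖ ^ 2 +
          ∑' j, ‖fourierD (u (j + n)) ξ‖ ^ 2 := ((hsum ξ).sum_add_tsum_nat_add n).symm
      rw [hmξ, add_sub_cancel_left,
        abs_of_nonneg (tsum_nonneg fun j => by positivity), ← tsum_mul_right]
      exact Summable.tsum_le_tsum (fun j => hgeou (j + n) ξ)
        ((summable_nat_add_iff n).2 (hsum ξ)) (((summable_nat_add_iff n).2 hgs).mul_right _)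
    have hbd : ∀ n, eLpNorm (fun x => distConv Φ (testFunction f hf hc) x -
        ((∑ j ∈ Finset.range n, conv (reflect (u j)) (conv (u j) f) x : ℝ) : ℂ)) 2 volume ≤
        ENNReal.ofReal (∑' j, D * q ^ (j + n)) *
        eLpNorm (fun ξ : EuclideanSpace ℝ (Fin d) => ((1 + ‖ξ‖ ^ 2 : ℝ) : ℂ) * T ξ) 2 volume := by
      intro n
      rw [funext (hdiff n)]
      refine (eLpNorm_multiplier_le T
        (a := fun ξ => m ξ - ∑ j ∈ Finset.range n, ‖fourierD (u j) ξ‖ ^ 2)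
        (hmm.sub (hpart n)) (K := 4 * B) (fun ξ => ?_) (htail n)).2
      have h1 : ∑ j ∈ Finset.range n, ‖fourierD (u j) ξ‖ ^ 2 ≤ m ξ :=
        (hsum ξ).sum_le_tsum (Finset.range n) fun j _ => by positivity
      have h2 : 0 ≤ ∑ j ∈ Finset.range n, ‖fourierD (u j) ξ‖ ^ 2 :=
        Finset.sum_nonneg fun j _ => by positivity
      have h3 := hmK ξ
      rw [abs_of_nonneg (hm0 ξ)] at h3
      rw [abs_of_nonneg (sub_nonneg.2 h1)]
      linarith
    refine tendsto_of_tendsto_of_tendsto_of_le_of_le tendsto_const_nhds ?_ (fun n => bot_le) hbd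
    have h0 : Tendsto (fun n => ENNReal.ofReal (∑' j, D * q ^ (j + n))) atTop (𝓝 0) := by
      simpa using ENNReal.tendsto_ofReal (tendsto_sum_nat_add fun j => D * q ^ j)
    simpa using ENNReal.Tendsto.mul_const h0 (.inr hTlt.ne)
  · have hTm : ∀ n : ℕ, Integrable fun ξ => ‖ξ‖ ^ n * ‖T ξ‖ := fun n => T.integrable_pow_mul _ n
    have hsol := isWaveSolution_waveSol T.continuous hTm hfT
    have hTim : ∀ j, ∀ n : ℕ, Integrable fun ξ => ‖ξ‖ ^ n * ‖fourierD (u j) ξ * T ξ‖ := by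
      intro j n
      refine ((hTm n).bdd_mul (huc j).norm.aestronglyMeasurable
        (.of_forall fun ξ => by rw [norm_norm]; exact hubd j ξ)).congr (.of_forall fun ξ => ?_)
      simp only [norm_mul]; ring
    have hsolj : ∀ j, IsWaveSolution (conv (u j) f) (waveSol fun ξ => fourierD (u j) ξ * T ξ) :=
      fun j => isWaveSolution_waveSol ((huc j).mul T.continuous) (hTim j) (hfj j)
    refine ⟨hsol.isWellPosed, fun j => ⟨(hsolj j).isWellPosed, fun S => ?_⟩⟩
    -- away from time `0` the even extension of the data is the solution formula itself
    have hext : ∀ (z : S) (σ : ℝ), σ ≠ 0 →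
        evenExt (fun τ => waveOp S f (z, τ)) σ = waveSol T ((z : EuclideanSpace ℝ (Fin d)), σ) := by
      intro z σ hσ
      rw [evenExt, dif_pos (abs_pos.2 hσ), hsol.waveOp_eq]
      rcases abs_choice σ with h | h
      · simp only [h]
      · simp only [h, waveSol, mul_neg, Real.cos_neg]
    have hae : ∀ (z : S) (t : ℝ), (fun s => v j s * waveSol T ((z : EuclideanSpace ℝ (Fin d)), t - s))
        =ᵐ[volume] fun s => v j s * evenExt (fun τ => waveOp S f (z, τ)) (t - s) := by
      intro z t
      have hne : ∀ᵐ s : ℝ, s ≠ t := by simp [ae_iff]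
      filter_upwards [hne] with s hs
      rw [hext z _ (sub_ne_zero.2 hs.symm)]
    refine ⟨fun z t => ?_, funext fun z => ?_⟩
    · have hcont : Continuous fun s => waveSol T ((z : EuclideanSpace ℝ (Fin d)), t - s) :=
        (contDiff_waveSol T.continuous hTm).continuous.comp (by fun_prop)
      have hI : Integrable fun s => v j s * waveSol T ((z : EuclideanSpace ℝ (Fin d)), t - s) :=
        (hvi j).mul_bdd hcont.aestronglyMeasurable
          (.of_forall fun s => norm_waveSol_le T.integrable _)
      exact hI.congr (hae z t)
    · have h1 := integral_congr_ae (hae z.1 (z.2 : ℝ))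
      rw [integral_mul_waveSol (hvi j) (heven j) T.integrable] at h1
      have he : (fun ξ => fourierD (u j) ξ * T ξ) = fun ξ => fourierD (v j) ‖ξ‖ * T ξ :=
        funext fun ξ => by rw [(hspec j).2]
      rw [(hsolj j).waveOp_eq, he]
      exact h1
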